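/- **Theorem (Generators).** Let $R$ be a commutative ring and let $n,m\ge 1$ be integers. Let $A_R(n,m)=R[x_i(j) : 1\le i\le m,\ 1\le j\le n]$, on which the symmetric group $S_n$ acts by $\sigma(x_i(j))=x_i(\sigma(j))$, and let $A_R(n,m)^{S_n}$ be the ring of invariants. For $f\in R[y_1,\dots,y_m]$ put $f(j)=f(x_1(j),\dots,x_m(j))$, and let $e_k(f)=e_k(f(1),\dots,f(n))$ be the $k$-th elementary symmetric polynomial evaluated at $f(1),\dots,f(n)$. A monomial $\mu=y_1^{a_1}\cdots y_m^{a_m}$ has total degree $l(\mu)=a_1+\dots+a_m$; it is called primitive if it has positive degree and is not a power of another monomial. Degrees of elements of $A_R(n,m)$ are total degrees, with every $x_i(j)$ of degree $1$. Put $N=\max(n,\,m(n-1))$. 1. $A_R(n,m)^{S_n}$ is generated as an $R$-algebra by the elements $e_k(\mu)$ with $\mu$ a primitive monomial, $1\le k\le n$ and total degree of $e_k(\mu)$ at most $N$. 2. Suppose that $n=p^s$ with $p$ prime and $s\ge 0$, and that either $R\cong\mathbb Z$ or $R\ne 0$ and $p\cdot 1_R=0$. Then the bound $N$ is attained: every set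 of generators of the $R$-algebra $A_R(n,m)^{S_n}$ contains an element of total degree at least $N$, and every set of homogeneous generators contains an element of total degree exactly $N$. 3. If $R$ contains $\mathbb Q$, then $A_R(n,m)^{S_n}$ is generated as an $R$-algebra by the elements $e_1(\mu)=\mu(1)+\dots+\mu(n)$ with $\mu$ a monomial and $1\le l(\mu)\le n$. -/

import Mathlib

namespace Multisymmetric

open MvPolynomial

/-- The invariant ring `A_R(n,m)^{S_n}`. The ring `A_R(n,m)` is
`MvPolynomial (Fin m × Fin n) R`, where `X (i, j)` is the variable `x_i(j)`, and `σ` in `S_n`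
acts by `x_i(j) ↦ x_i(σ j)`. -/
def invariants (R : Type*) [CommRing R] (n m : ℕ) :
    Subalgebra R (MvPolynomial (Fin m × Fin n) R) where
  carrier := {f | ∀ σ : Equiv.Perm (Fin n), rename (fun q : Fin m × Fin n => (q.1, σ q.2)) f = f}
  mul_mem' := fun ha hb σ => by rw [map_mul, ha σ, hb σ]
  add_mem' := fun ha hb σ => by rw [map_add, ha σ, hb σ]
  algebraMap_mem' := fun r σ => (rename _).commutes r

/-- `f(j) = f(x_1(j), …, x_m(j))` for `f` in `R[y_1, …, y_m]`. -/
noncomputable def at_ {R : Type*} [CommRing R] {n m : ℕ} (f : MvPolynomial (Fin m) R)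
    (j : Fin n) : MvPolynomial (Fin m × Fin n) R :=
  aeval (fun i : Fin m => (X (i, j) : MvPolynomial (Fin m × Fin n) R)) f

/-- `e_k(f) = e_k(f(1), …, f(n))`, the `k`-th elementary symmetric polynomial in `n` variables
evaluated at `f(1), …, f(n)`. -/
noncomputable def e {R : Type*} [CommRing R] (n : ℕ) {m : ℕ} (k : ℕ)
    (f : MvPolynomial (Fin m) R) : MvPolynomial (Fin m × Fin n) R :=
  aeval (fun j : Fin n => at_ f j) (esymm (Fin n) R k)

/-- The monomial `y^a` of `R[y_1, …, y_m]` with exponent vector `a`. -/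
noncomputable def mon (R : Type*) [CommRing R] {m : ℕ} (a : Fin m →₀ ℕ) :
    MvPolynomial (Fin m) R :=
  monomial a 1

/-- `y^a` is primitive: it has positive degree and is not a power of another monomial
(`(y^b)^k = y^(k • b)`). -/
def IsPrimitive {m : ℕ} (a : Fin m →₀ ℕ) : Prop :=
  a ≠ 0 ∧ ∀ (b : Fin m →₀ ℕ) (k : ℕ), a = k • b → b = a

/-- The degree bound `max(n, m(n - 1))`; the subtraction is the true one for `1 ≤ n`. -/
def bound (n m : ℕ) : ℕ := max n (m * (n - 1))

end Multisymmetric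

/-! A monomial in the $x_i(j)$ puts a monomial in the $y_i$ into each of $n$ slots. Given such a
filling `β`, multiply the $e_c(v)$ over its nonzero values $v$, with $c$ the multiplicity of $v$.
The result is the orbit sum of `β` plus monomials that occupy fewer slots, because overlaps merge
slots. By this triangularity the $e_k(\mu)$ generate, and the fundamental theorem of symmetric
polynomials reduces to primitive $\mu$ (`adjoin_primitiveGenerators`).

For $n=p^s$, the functional `slotCoeff` detects indecomposables modulo $p$. Identifying the slots
sends $e_k(\mu)$ to $\binom nk\mu^k$, so modulo $p$ invariants become polynomials in the $y_l^n$. If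
no $n\nu\le d$ occurs except $0$ and possibly $d$, the Leibniz rule makes the invariants with
`slotCoeff` divisible by $p$ a subalgebra. Since $e_{n-1}(y_1\cdots y_m)$ or $e_n(y_1)$, whichever
has degree $N$, lies outside it, so does some generator (`bound_attained`).

For the upper bound, $k\,l(\mu)>N$ forces some variable to have exponent at least $n$ in $\mu^k$.
Over $\mathbb Z$ it suffices to find, for each prime $p$, an integer multiple of $e_k(\mu)$, prime
to $p$, that is decomposable. Pass to $p^s$ slots with $s$ large, and take the invariant `twoPart`
of the same multidegree that spreads this variable over separate slots. It is $c\,e_k(\mu)$ plus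
decomposables, and `slotCoeff` shows $p\nmid c$. It occupies more than $n$ slots, so setting the
extra slots to zero kills it and leaves the wanted relation (`exists_smul_e_mem_lowDegree`). Base
change gives every $R$.

Over $\mathbb Q$, a sum over $n+1$ distinct indices is empty; expanding it makes $n!\,e_1(\mu)$
decomposable when $l(\mu)>n$ (`injSum_sub_mem_lowPowerSums`). Newton's identities do the rest. -/

namespace Multisymmetric

open MvPolynomial Finset

/-! ### Monomials as fillings of slots -/

section Slots

variable {R : Type*} [CommRing R] {n m : ℕ}

/-- The exponent vector in the variables `x_i(j)` whose part at the index `j` is `β j`. -/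
noncomputable def ofSlots (β : Fin n → Fin m →₀ ℕ) : Fin m × Fin n →₀ ℕ :=
  Finsupp.equivFunOnFinite.symm fun q => β q.2 q.1

/-- The part of an exponent vector that involves the variables `x_i(j)` for a fixed `j`. -/
noncomputable def slots (α : Fin m × Fin n →₀ ℕ) (j : Fin n) : Fin m →₀ ℕ :=
  Finsupp.equivFunOnFinite.symm fun i => α (i, j)

@[simp] lemma ofSlots_apply (β : Fin n → Fin m →₀ ℕ) (q : Fin m × Fin n) :
    ofSlots β q = β q.2 q.1 := rfl

@[simp] lemma slots_apply (α : Fin m × Fin n →₀ ℕ) (j : Fin n) (i : Fin m) :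
    slots α j i = α (i, j) := rfl

@[simp] lemma slots_ofSlots (β : Fin n → Fin m →₀ ℕ) : slots (ofSlots β) = β := by
  funext j
  ext i
  simp

@[simp] lemma ofSlots_slots (α : Fin m × Fin n →₀ ℕ) : ofSlots (slots α) = α := by
  ext q
  simp

lemma ofSlots_injective :
    Function.Injective (ofSlots : (Fin n → Fin m →₀ ℕ) → Fin m × Fin n →₀ ℕ) :=
  Function.LeftInverse.injective slots_ofSlots

lemma sum_ofSlots {ι : Type*} (s : Finset ι) (β : ι → Fin n → Fin m →₀ ℕ) :
    ∑ k ∈ s, ofSlots (β k) = ofSlots fun j => ∑ k ∈ s, β k j := by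
  ext q
  simp [Finsupp.finsetSum_apply]

lemma mapDomain_fst_apply (α : Fin m × Fin n →₀ ℕ) (i : Fin m) :
    α.mapDomain Prod.fst i = ∑ j, α (i, j) := by
  induction α using Finsupp.induction_linear with
  | zero => simp
  | add f g hf hg => simp [Finsupp.mapDomain_add, hf, hg, sum_add_distrib]
  | single q b =>
    obtain ⟨i', j'⟩ := q
    rw [Finsupp.mapDomain_single]
    by_cases h : i' = i
    · subst h
      simp [Finsupp.single_apply]
    · simp [h]

lemma mapDomain_fst_ofSlots (β : Fin n → Fin m →₀ ℕ) :
    (ofSlots β).mapDomain Prod.fst = ∑ j, β j := by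
  ext i
  simp [mapDomain_fst_apply, Finsupp.finsetSum_apply]

lemma ofSlots_comp_perm (β : Fin n → Fin m →₀ ℕ) (σ : Equiv.Perm (Fin n)) :
    (ofSlots (β ∘ σ)).mapDomain (fun q : Fin m × Fin n => (q.1, σ q.2)) = ofSlots β := by
  have h := Finsupp.equivMapDomain_eq_mapDomain ((Equiv.refl (Fin m)).prodCongr σ)
    (ofSlots (β ∘ σ))
  have h2 : (⇑((Equiv.refl (Fin m)).prodCongr σ) : Fin m × Fin n → Fin m × Fin n)
      = fun q => (q.1, σ q.2) := by
    ext q <;> rfl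
  rw [h2] at h
  rw [← h]
  ext ⟨i, j⟩
  simp [Finsupp.equivMapDomain_apply]

lemma perm_injective (σ : Equiv.Perm (Fin n)) :
    Function.Injective (fun q : Fin m × Fin n => (q.1, σ q.2)) := by
  rintro ⟨a, b⟩ ⟨c, d⟩ h
  simpa using h

lemma rename_perm_monomial (σ : Equiv.Perm (Fin n)) (β : Fin n → Fin m →₀ ℕ) (r : R) :
    rename (fun q : Fin m × Fin n => (q.1, σ q.2)) (monomial (ofSlots (β ∘ σ)) r) =
      monomial (ofSlots β) r := by
  rw [rename_monomial, ofSlots_comp_perm]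

lemma coeff_comp_perm {g : MvPolynomial (Fin m × Fin n) R} (hg : g ∈ invariants R n m)
    (β : Fin n → Fin m →₀ ℕ) (σ : Equiv.Perm (Fin n)) :
    coeff (ofSlots (β ∘ σ)) g = coeff (ofSlots β) g := by
  have h := coeff_rename_mapDomain _ (perm_injective (m := m) σ) g (ofSlots (β ∘ σ))
  rw [ofSlots_comp_perm, hg σ] at h
  exact h.symm

lemma rename_perm_at (σ : Equiv.Perm (Fin n)) (f : MvPolynomial (Fin m) R) (j : Fin n) :
    rename (fun q : Fin m × Fin n => (q.1, σ q.2)) (at_ f j) = at_ f (σ j) := by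
  have h : (rename (fun q : Fin m × Fin n => (q.1, σ q.2))).comp
      (aeval (fun i : Fin m => (X (i, j) : MvPolynomial (Fin m × Fin n) R))) =
      aeval (fun i : Fin m => (X (i, σ j) : MvPolynomial (Fin m × Fin n) R)) := by
    ext i
    simp
  exact DFunLike.congr_fun h f

lemma e_mem_invariants (k : ℕ) (f : MvPolynomial (Fin m) R) : e n k f ∈ invariants R n m := by
  intro σ
  have h : (rename (fun q : Fin m × Fin n => (q.1, σ q.2))).comp
      (aeval (fun j : Fin n => (at_ f j : MvPolynomial (Fin m × Fin n) R))) =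
      (aeval (fun j : Fin n => (at_ f j : MvPolynomial (Fin m × Fin n) R))).comp
        (rename σ) := by
    ext j
    simp [rename_perm_at]
  have h2 := DFunLike.congr_fun h (esymm (Fin n) R k)
  simp only [AlgHom.comp_apply, rename_esymm] at h2
  exact h2

lemma at_mon (a : Fin m →₀ ℕ) (j : Fin n) :
    at_ (mon R a) j = monomial (ofSlots fun l => if l = j then a else 0) (1 : R) := by
  have h : at_ (mon R a) j = rename (fun i : Fin m => (i, j)) (mon R a) := by
    rw [rename_eq_aeval]; rfl
  rw [h, mon, rename_monomial]
  refine congrArg (fun α => monomial α (1 : R)) (Finsupp.ext fun ⟨i, l⟩ => ?_)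
  by_cases hl : l = j
  · subst hl
    simpa using Finsupp.mapDomain_apply (f := fun i : Fin m => (i, l))
      (fun x y h => by simpa using h) a i
  · rw [Finsupp.mapDomain_of_notMem_range]
    · simp [hl]
    · rintro ⟨i', h⟩
      simp only [Prod.mk.injEq] at h
      exact hl h.2.symm

lemma e_eq_sum (k : ℕ) (f : MvPolynomial (Fin m) R) :
    (e n k f : MvPolynomial (Fin m × Fin n) R) = ∑ J ∈ powersetCard k univ, ∏ j ∈ J, at_ f j := by
  simp [e, esymm, map_sum, map_prod]

lemma prod_at_mon (a : Fin m →₀ ℕ) (J : Finset (Fin n)) :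
    ∏ j ∈ J, (at_ (mon R a) j : MvPolynomial (Fin m × Fin n) R) =
      monomial (ofSlots fun j => if j ∈ J then a else 0) 1 := by
  simp_rw [at_mon]
  rw [← monomial_sum_one, sum_ofSlots]
  simp

lemma e_mon (k : ℕ) (a : Fin m →₀ ℕ) :
    (e n k (mon R a) : MvPolynomial (Fin m × Fin n) R) =
      ∑ J ∈ powersetCard k univ, monomial (ofSlots fun j => if j ∈ J then a else 0) 1 := by
  simp_rw [e_eq_sum, prod_at_mon]

lemma e_eq_zero {k : ℕ} (hk : n < k) (f : MvPolynomial (Fin m) R) :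
    (e n k f : MvPolynomial (Fin m × Fin n) R) = 0 := by
  rw [e_eq_sum, powersetCard_eq_empty.2 (by simpa using hk), sum_empty]

@[simp] lemma at_mul (f g : MvPolynomial (Fin m) R) (j : Fin n) :
    (at_ (f * g) j : MvPolynomial (Fin m × Fin n) R) = at_ f j * at_ g j := map_mul _ _ _

@[simp] lemma at_pow (f : MvPolynomial (Fin m) R) (k : ℕ) (j : Fin n) :
    (at_ (f ^ k) j : MvPolynomial (Fin m × Fin n) R) = at_ f j ^ k := map_pow _ _ _

lemma mon_nsmul (k : ℕ) (a : Fin m →₀ ℕ) : mon R (k • a) = mon R a ^ k := by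
  simp [mon, monomial_pow]

lemma mon_add (a b : Fin m →₀ ℕ) : mon R (a + b) = mon R a * mon R b := by
  simp [mon, monomial_mul]

end Slots

/-! ### Generation by the $e_k(\mu)$ with $\mu$ primitive -/

section Generation

variable {R : Type*} [CommRing R] {n m : ℕ}

/-- The number of indices `j` for which some variable `x_i(j)` occurs. -/
def numSlots (β : Fin n → Fin m →₀ ℕ) : ℕ := #{j | β j ≠ 0}

/-- The nonzero values of `β`. -/
def nonzeroValues (β : Fin n → Fin m →₀ ℕ) : Finset (Fin m →₀ ℕ) := (univ.image β).erase 0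

/-- The product of the `e_c(v)`, for `v` a nonzero value that `β` takes `c` times. -/
noncomputable def valueProduct (R : Type*) [CommRing R] (β : Fin n → Fin m →₀ ℕ) :
    MvPolynomial (Fin m × Fin n) R :=
  ∏ v : nonzeroValues β, e n #{j | β j = v} (mon R v.1)

/-- The families of index sets over which `valueProduct` expands. -/
def valueSets (β : Fin n → Fin m →₀ ℕ) : Finset (nonzeroValues β → Finset (Fin n)) :=
  Fintype.piFinset fun v => powersetCard #{j | β j = v} univ

/-- The exponents that carry, at each index `j`, the sum of the `v` with `j ∈ J v`. -/
noncomputable def ofValueSets {β : Fin n → Fin m →₀ ℕ} (J : nonzeroValues β → Finset (Fin n))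
    (j : Fin n) : Fin m →₀ ℕ :=
  ∑ v : nonzeroValues β, if j ∈ J v then v.1 else 0

lemma valueProduct_eq_sum (β : Fin n → Fin m →₀ ℕ) :
    valueProduct R β = ∑ J ∈ valueSets β, monomial (ofSlots (ofValueSets J)) 1 := by
  simp_rw [valueProduct, e_mon]
  rw [prod_univ_sum]
  refine sum_congr rfl fun J _ => ?_
  rw [← monomial_sum_one, sum_ofSlots]
  rfl

lemma numSlots_eq_sum (β : Fin n → Fin m →₀ ℕ) :
    numSlots β = ∑ v : nonzeroValues β, #{j | β j = v} := by
  rw [numSlots, card_eq_sum_card_fiberwise (f := β) (t := nonzeroValues β)]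
  · rw [← sum_coe_sort]
    refine sum_congr rfl fun v _ => ?_
    congr 1
    ext j
    simp only [mem_filter, mem_univ, true_and, and_iff_right_iff_imp]
    rintro h
    rw [h]
    exact (mem_erase.1 v.2).1
  · intro j hj
    simp only [coe_filter, mem_univ, true_and, Set.mem_ofPred_eq] at hj
    simp [nonzeroValues, hj]

/-- Double counting of the pairs $(j,v)$ with `j ∈ J v`. -/
lemma sum_card_valueSets {β : Fin n → Fin m →₀ ℕ} {J : nonzeroValues β → Finset (Fin n)}
    (hJ : J ∈ valueSets β) : ∑ j, #{v | j ∈ J v} = numSlots β := by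
  have h := sum_card_bipartiteAbove_eq_sum_card_bipartiteBelow
    (s := (univ : Finset (Fin n))) (t := (univ : Finset (nonzeroValues β))) (fun j v => j ∈ J v)
  simp only [bipartiteAbove, bipartiteBelow] at h
  rw [h, numSlots_eq_sum]
  refine sum_congr rfl fun v _ => ?_
  rw [← (mem_powersetCard.1 (Fintype.mem_piFinset.1 hJ v)).2]
  congr 1
  ext
  simp

lemma ite_ofValueSets_le {β : Fin n → Fin m →₀ ℕ} (J : nonzeroValues β → Finset (Fin n))
    (j : Fin n) : (if ofValueSets J j ≠ 0 then 1 else 0) ≤ #{v | j ∈ J v} := by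
  split_ifs with h
  · rw [Nat.one_le_iff_ne_zero, Ne, card_eq_zero, ← Ne, ← nonempty_iff_ne_empty]
    by_contra hne
    rw [not_nonempty_iff_eq_empty, filter_eq_empty_iff] at hne
    exact h (sum_eq_zero fun v hv => if_neg (hne hv))
  · exact Nat.zero_le _

lemma numSlots_eq_sum_ite (β : Fin n → Fin m →₀ ℕ) :
    numSlots β = ∑ j, if β j ≠ 0 then 1 else 0 := by
  simp [numSlots, card_filter]

lemma numSlots_ofValueSets_le {β : Fin n → Fin m →₀ ℕ} {J : nonzeroValues β → Finset (Fin n)}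
    (hJ : J ∈ valueSets β) : numSlots (ofValueSets J) ≤ numSlots β := by
  rw [numSlots_eq_sum_ite, ← sum_card_valueSets hJ]
  exact sum_le_sum fun j _ => ite_ofValueSets_le J j

/-- Equality in the double count holds index by index, so each index lies in at most one `J v` and
no two values are added. -/
lemma mem_iff_of_numSlots_le {β : Fin n → Fin m →₀ ℕ} {J : nonzeroValues β → Finset (Fin n)}
    (hJ : J ∈ valueSets β) (h : numSlots β ≤ numSlots (ofValueSets J)) (j : Fin n) :
    (∀ v, j ∈ J v ↔ ofValueSets J j = v.1) ∧
      (ofValueSets J j ≠ 0 → ofValueSets J j ∈ nonzeroValues β) := by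
  have h1 := le_antisymm h (numSlots_ofValueSets_le hJ)
  rw [← sum_card_valueSets hJ, numSlots_eq_sum_ite, eq_comm,
    sum_eq_sum_iff_of_le fun j _ => ite_ofValueSets_le J j] at h1
  have h2 := h1 j (mem_univ j)
  split_ifs at h2 with h0
  · obtain ⟨v, hv⟩ := card_eq_one.1 h2.symm
    have hval : ofValueSets J j = v.1 := by
      rw [ofValueSets, ← sum_filter, hv, sum_singleton]
    refine ⟨fun u => ?_, fun _ => hval ▸ v.2⟩
    have hu : j ∈ J u ↔ u = v := by
      have := congrArg (u ∈ ·) hv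
      simpa using this
    rw [hu, hval, eq_comm, Subtype.ext_iff]
  · rw [not_ne_iff] at h0
    refine ⟨fun u => ?_, fun h => absurd h0 h⟩
    have hu : j ∉ J u := by
      have := card_eq_zero.1 h2.symm
      rw [filter_eq_empty_iff] at this
      exact this (mem_univ u)
    rw [h0]
    exact ⟨fun h => absurd h hu, fun h => absurd h.symm (mem_erase.1 u.2).1⟩

lemma exists_perm_of_card_eq {α β : Fin n → Fin m →₀ ℕ}
    (h : ∀ v, #{j | α j = v} = #{j | β j = v}) : ∃ σ : Equiv.Perm (Fin n), α = β ∘ σ := by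
  have hc : ∀ v, Nonempty ({j // α j = v} ≃ {j // β j = v}) := fun v =>
    Fintype.card_eq.1 (by simpa [Fintype.card_subtype] using h v)
  exact ⟨Equiv.ofFiberEquiv fun v => (hc v).some, funext fun j =>
    (Equiv.ofFiberEquiv_map (fun v => (hc v).some) j).symm⟩

lemma card_zero_add_numSlots (β : Fin n → Fin m →₀ ℕ) : #{j | β j = 0} + numSlots β = n := by
  simpa [numSlots] using card_filter_add_card_filter_not (s := (univ : Finset (Fin n))) (fun j => β j = 0)

lemma ofValueSets_perm {β : Fin n → Fin m →₀ ℕ} {J : nonzeroValues β → Finset (Fin n)}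
    (hJ : J ∈ valueSets β) (h : numSlots β ≤ numSlots (ofValueSets J)) :
    ∃ σ : Equiv.Perm (Fin n), ofValueSets J = β ∘ σ := by
  refine exists_perm_of_card_eq fun v => ?_
  have key := mem_iff_of_numSlots_le hJ h
  by_cases h0 : v = 0
  · subst h0
    have h1 := card_zero_add_numSlots β
    have h2 := card_zero_add_numSlots (ofValueSets J)
    have h3 := numSlots_ofValueSets_le hJ
    omega
  · by_cases hv : v ∈ nonzeroValues β
    · rw [← (mem_powersetCard.1 (Fintype.mem_piFinset.1 hJ ⟨v, hv⟩)).2]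
      congr 1
      ext j
      simp [(key j).1 ⟨v, hv⟩]
    · rw [filter_false_of_mem, filter_false_of_mem]
      · rintro j - rfl
        exact hv (by simp [nonzeroValues, h0])
      · rintro j - rfl
        exact hv ((key j).2 h0)

/-- Only the family of fibres of `β` contributes, by the rigidity of `mem_iff_of_numSlots_le`. -/
lemma coeff_valueProduct_self (β : Fin n → Fin m →₀ ℕ) :
    coeff (ofSlots β) (valueProduct R β) = 1 := by
  classical
  have hmem : (fun v : nonzeroValues β => univ.filter fun j => β j = v.1) ∈ valueSets β :=
    Fintype.mem_piFinset.2 fun v => mem_powersetCard.2 ⟨subset_univ _, rfl⟩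
  rw [valueProduct_eq_sum, coeff_sum, sum_eq_single_of_mem _ hmem]
  · rw [coeff_monomial, if_pos]
    congr 1
    funext j
    simp only [ofValueSets, mem_filter, mem_univ, true_and]
    by_cases h0 : β j = 0
    · rw [h0]
      exact sum_eq_zero fun v _ => if_neg (mem_erase.1 v.2).1.symm
    · rw [sum_eq_single (⟨β j, by simp [nonzeroValues, h0]⟩ : nonzeroValues β)]
      · simp
      · intro v _ hv
        exact if_neg fun h => hv (Subtype.ext h.symm)
      · simp
  · intro J hJ hne
    rw [coeff_monomial, if_neg]
    intro h
    have h := ofSlots_injective h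
    refine hne (funext fun v => ?_)
    ext j
    rw [(mem_iff_of_numSlots_le hJ (by rw [h]) j).1 v, h]
    simp

lemma valueProduct_mem_invariants (β : Fin n → Fin m →₀ ℕ) :
    valueProduct R β ∈ invariants R n m :=
  prod_mem fun _ _ => e_mem_invariants _ _

lemma exists_perm_of_coeff_ne_zero {β γ : Fin n → Fin m →₀ ℕ}
    (hc : coeff (ofSlots γ) (valueProduct R β) ≠ 0) (h : numSlots β ≤ numSlots γ) :
    ∃ σ : Equiv.Perm (Fin n), γ = β ∘ σ := by
  classical
  rw [valueProduct_eq_sum, coeff_sum] at hc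
  obtain ⟨J, hJ, hne⟩ := exists_ne_zero_of_sum_ne_zero hc
  rw [coeff_monomial] at hne
  have hγ : ofValueSets J = γ := by
    by_contra hcon
    exact hne (if_neg fun h => hcon (ofSlots_injective h))
  subst hγ
  exact ofValueSets_perm hJ h

/-- The elements `e_k(μ)` with `μ` a monomial of positive degree and `1 ≤ k ≤ n`. -/
def elementaryGenerators (R : Type*) [CommRing R] (n m : ℕ) :
    Set (MvPolynomial (Fin m × Fin n) R) :=
  {g | ∃ (a : Fin m →₀ ℕ) (k : ℕ), a ≠ 0 ∧ 1 ≤ k ∧ k ≤ n ∧ g = e n k (mon R a)}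

lemma valueProduct_mem_adjoin (β : Fin n → Fin m →₀ ℕ) :
    valueProduct R β ∈ Algebra.adjoin R (elementaryGenerators R n m) := by
  refine prod_mem fun v _ => Algebra.subset_adjoin
    ⟨v.1, _, (mem_erase.1 v.2).1, ?_, ?_, rfl⟩
  · rw [Nat.one_le_iff_ne_zero, Ne, card_eq_zero, filter_eq_empty_iff]
    intro h
    obtain ⟨j, -, hj⟩ := mem_image.1 (mem_erase.1 v.2).2
    exact h (mem_univ j) hj
  · exact (card_le_univ _).trans (by simp)

lemma invariants_le_adjoin_elementaryGenerators :
    invariants R n m ≤ Algebra.adjoin R (elementaryGenerators R n m) := by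
  classical
  -- Induction on a bound `s` for the number of occupied slots, then on a bound `c` for the number
  -- of monomials that attain it.
  have key : ∀ s c : ℕ, ∀ g ∈ invariants R n m,
      (∀ α ∈ g.support, numSlots (slots α) ≤ s) →
      #{α ∈ g.support | numSlots (slots α) = s} ≤ c →
      g ∈ Algebra.adjoin R (elementaryGenerators R n m) := by
    intro s
    induction s with
    | zero =>
      intro c g _ hs _
      have : g = C (coeff 0 g) := by
        refine MvPolynomial.ext _ _ fun α => ?_
        rw [coeff_C]
        split_ifs with h
        · rw [h]
        · by_contra hne
          have h1 := hs α (mem_support_iff.2 hne)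
          rw [Nat.le_zero, numSlots, card_eq_zero, filter_eq_empty_iff] at h1
          refine h ?_
          ext ⟨i, j⟩
          have := h1 (mem_univ j)
          rw [not_ne_iff] at this
          simpa using (DFunLike.congr_fun this i).symm
      rw [this]
      exact Subalgebra.algebraMap_mem _ _
    | succ s ihs =>
      intro c
      induction c with
      | zero =>
        intro g hg hs hc
        refine ihs _ g hg (fun α hα => ?_) le_rfl
        rw [Nat.le_zero, card_eq_zero, filter_eq_empty_iff] at hc
        have h1 := hs α hα
        have h2 := hc hα
        omega
      | succ c ihc =>
        intro g hg hs hc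
        by_cases hcc : #{α ∈ g.support | numSlots (slots α) = s + 1} = 0
        · exact ihc g hg hs (by omega)
        obtain ⟨α, hα⟩ := card_pos.1 (Nat.pos_of_ne_zero hcc)
        rw [mem_filter] at hα
        set β := slots α with hβ
        have hgβ : g - C (coeff α g) * valueProduct R β ∈
            Algebra.adjoin R (elementaryGenerators R n m) := by
          have hinv : g - C (coeff α g) * valueProduct R β ∈ invariants R n m :=
            sub_mem hg (mul_mem (Subalgebra.algebraMap_mem _ _) (valueProduct_mem_invariants β))
          -- With at least `s + 1` slots, `valueProduct R β` involves only the orbit of `β`. There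
          -- invariance makes all coefficients of `g` equal, so the subtraction clears the orbit,
          -- `α` included.
          have hcoeff : ∀ γ, s + 1 ≤ numSlots (slots γ) →
              coeff γ (g - C (coeff α g) * valueProduct R β) ≠ 0 → coeff γ g ≠ 0 ∧ γ ≠ α := by
            intro γ hγ hne
            by_cases h0 : coeff γ (valueProduct R β) = 0
            · rw [coeff_sub, coeff_C_mul, h0, mul_zero, sub_zero] at hne
              refine ⟨hne, ?_⟩
              rintro rfl
              apply hne
              have := coeff_valueProduct_self (R := R) β
              rw [hβ, ofSlots_slots, h0] at this
              rw [← mul_one (coeff γ g), ← this, mul_zero]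
            · exfalso
              obtain ⟨σ, hσ⟩ := exists_perm_of_coeff_ne_zero (γ := slots γ) (β := β)
                (by rwa [ofSlots_slots]) (by rw [hα.2]; exact hγ)
              have h1 := coeff_comp_perm hg β σ
              have h2 := coeff_comp_perm (valueProduct_mem_invariants (R := R) β) β σ
              rw [← hσ, ofSlots_slots] at h1 h2
              rw [coeff_valueProduct_self] at h2
              rw [hβ, ofSlots_slots] at h1
              rw [coeff_sub, coeff_C_mul, h1, h2, mul_one, sub_self] at hne
              exact hne rfl
          refine ihc _ hinv (fun γ hγ => ?_) ?_
          · by_contra hcon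
            push Not at hcon
            have := hs γ (mem_support_iff.2 (hcoeff γ hcon.le (mem_support_iff.1 hγ)).1)
            omega
          · have hlt : #{γ ∈ (g - C (coeff α g) * valueProduct R β).support |
                numSlots (slots γ) = s + 1} < #{γ ∈ g.support | numSlots (slots γ) = s + 1} := by
              refine card_lt_card ((ssubset_iff_of_subset ?_).2 ⟨α, mem_filter.2 hα, ?_⟩)
              · intro γ hγ
                rw [mem_filter, mem_support_iff] at hγ ⊢
                exact ⟨(hcoeff γ hγ.2.ge hγ.1).1, hγ.2⟩
              · intro hcon
                rw [mem_filter, mem_support_iff] at hcon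
                exact (hcoeff α hcon.2.ge hcon.1).2 rfl
            omega
        have := add_mem hgβ (mul_mem (Subalgebra.algebraMap_mem _ (coeff α g))
          (valueProduct_mem_adjoin (R := R) β))
        rwa [algebraMap_eq, sub_add_cancel] at this
  intro g hg
  exact key n _ g hg (fun α _ => (card_le_univ _).trans (by simp)) le_rfl

/-- The elements `e_k(μ)` with `μ` a primitive monomial and `1 ≤ k ≤ n`. -/
def primitiveGenerators (R : Type*) [CommRing R] (n m : ℕ) :
    Set (MvPolynomial (Fin m × Fin n) R) :=
  {g | ∃ (a : Fin m →₀ ℕ) (k : ℕ), IsPrimitive a ∧ 1 ≤ k ∧ k ≤ n ∧ g = e n k (mon R a)}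

lemma exists_nsmul_isPrimitive (a : Fin m →₀ ℕ) (ha : a ≠ 0) :
    ∃ (b : Fin m →₀ ℕ) (k : ℕ), IsPrimitive b ∧ a = k • b := by
  induction hd : a.degree using Nat.strong_induction_on generalizing a with
  | _ d ih =>
    by_cases hp : IsPrimitive a
    · exact ⟨a, 1, hp, (one_smul _ _).symm⟩
    · simp only [IsPrimitive, not_and, not_forall] at hp
      obtain ⟨b, k, hk, hne⟩ := hp ha
      have hb : b ≠ 0 := by
        rintro rfl
        exact ha (by rw [hk, smul_zero])
      have hk2 : 2 ≤ k := by
        rcases k with _ | _ | k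
        · exact absurd (by rw [hk, zero_smul]) ha
        · exact absurd (by rw [hk, zero_add, one_smul]) hne
        · omega
      have hb0 : b.degree ≠ 0 := by rwa [Ne, Finsupp.degree_eq_zero_iff]
      have hdeg : a.degree = k * b.degree := by rw [hk, map_nsmul, smul_eq_mul]
      obtain ⟨c, l, hc, hl⟩ := ih b.degree (by
        rw [← hd, hdeg]; nlinarith [Nat.pos_of_ne_zero hb0]) b hb rfl
      exact ⟨c, k * l, hc, by rw [hk, hl, mul_smul]⟩

/-- $e_k(\mu^i)$ is symmetric in $\mu(1),\dots,\mu(n)$, hence a polynomial in the $e_l(\mu)$. -/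
lemma e_mem_adjoin_primitiveGenerators {a : Fin m →₀ ℕ} (ha : a ≠ 0) (k : ℕ) :
    e n k (mon R a) ∈ Algebra.adjoin R (primitiveGenerators R n m) := by
  obtain ⟨b, i, hb, rfl⟩ := exists_nsmul_isPrimitive a ha
  have hsymm : (expand i (esymm (Fin n) R k)) ∈ symmetricSubalgebra (Fin n) R := by
    rw [mem_symmetricSubalgebra]
    intro σ
    rw [rename_expand, rename_esymm]
  obtain ⟨q, hq⟩ := esymmAlgHom_surjective (σ := Fin n) R (n := n) (by simp) ⟨_, hsymm⟩
  have hq' : (aeval fun l : Fin n => esymm (Fin n) R (l + 1)) q =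
      expand i (esymm (Fin n) R k) := by
    rw [← esymmAlgHom_apply, hq]
  have he : e n k (mon R (i • b)) =
      aeval (fun l : Fin n => (e n (l + 1) (mon R b) : MvPolynomial (Fin m × Fin n) R)) q := by
    have h1 := congrArg (aeval fun j : Fin n =>
      (at_ (mon R b) j : MvPolynomial (Fin m × Fin n) R)) hq'
    rw [aeval_expand, ← AlgHom.comp_apply, comp_aeval] at h1
    rw [e]
    simp_rw [mon_nsmul, at_pow]
    exact h1.symm
  rw [he]
  have hmem := AlgHom.mem_range_self
    (aeval (fun l : Fin n => (e n (l + 1) (mon R b) : MvPolynomial (Fin m × Fin n) R))) q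
  rw [← Algebra.adjoin_range_eq_range_aeval] at hmem
  refine Algebra.adjoin_mono ?_ hmem
  rintro _ ⟨l, rfl⟩
  exact ⟨b, l + 1, hb, by omega, by omega, rfl⟩

theorem adjoin_primitiveGenerators :
    Algebra.adjoin R (primitiveGenerators R n m) = invariants R n m := by
  refine le_antisymm (Algebra.adjoin_le ?_)
    (invariants_le_adjoin_elementaryGenerators.trans (Algebra.adjoin_le ?_))
  · rintro _ ⟨a, k, -, -, -, rfl⟩
    exact e_mem_invariants _ _
  · rintro _ ⟨a, k, ha, -, -, rfl⟩
    exact e_mem_adjoin_primitiveGenerators ha k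

end Generation

end Multisymmetric

namespace Multisymmetric

open MvPolynomial Finset

/-! ### A functional modulo $p$ that kills decomposables; the bound is attained -/

section SlotCoefficient

variable {R : Type*} [CommRing R] {n m : ℕ}

/-- The coefficient of `y^d` in the polynomial obtained from `x_i(j) ∂g/∂x_i(j)` by identifying
`x_l(1), …, x_l(n)` for every `l`. -/
noncomputable def slotCoeff (i : Fin m) (j : Fin n) (d : Fin m →₀ ℕ) :
    MvPolynomial (Fin m × Fin n) R →ₗ[R] R :=
  lcoeff R d ∘ₗ (rename Prod.fst).toLinearMap ∘ₗ LinearMap.mulLeft R (X (i, j)) ∘ₗ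
    (pderiv (i, j)).toLinearMap

lemma slotCoeff_apply (i : Fin m) (j : Fin n) (d : Fin m →₀ ℕ)
    (g : MvPolynomial (Fin m × Fin n) R) :
    slotCoeff i j d g = coeff d (X i * rename Prod.fst (pderiv (i, j) g)) := by
  simp [slotCoeff]

lemma slotCoeff_monomial (i : Fin m) (j : Fin n) (d : Fin m →₀ ℕ)
    (β : Fin n → Fin m →₀ ℕ) (r : R) :
    slotCoeff i j d (monomial (ofSlots β) r) = if ∑ l, β l = d then β j i * r else 0 := by
  classical
  have h : slotCoeff i j d (monomial (ofSlots β) r) =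
      coeff d (rename Prod.fst (X (i, j) * pderiv (i, j) (monomial (ofSlots β) r))) := rfl
  rw [h, X_mul_pderiv_monomial, map_nsmul, rename_monomial, mapDomain_fst_ofSlots, coeff_smul,
    coeff_monomial]
  simp

lemma rename_fst_e_mon (k : ℕ) (a : Fin m →₀ ℕ) :
    rename Prod.fst (e n k (mon R a)) = monomial (k • a) (n.choose k : R) := by
  have h : ∀ J ∈ powersetCard k (univ : Finset (Fin n)),
      monomial ((ofSlots fun j => if j ∈ J then a else 0).mapDomain Prod.fst) (1 : R) =
        monomial (k • a) 1 := by
    intro J hJ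
    rw [mapDomain_fst_ofSlots, ← (mem_powersetCard.1 hJ).2]
    simp
  rw [e_mon, map_sum]
  simp_rw [rename_monomial]
  rw [sum_congr rfl h, sum_const, card_powersetCard, card_univ, Fintype.card_fin,
    ← map_nsmul, nsmul_one]

/-- The polynomials whose coefficient at every exponent outside `n • ℕ^m` is divisible by `p`. -/
def divisibleOffMultiples (R : Type*) [CommRing R] (n m p : ℕ) :
    Subalgebra R (MvPolynomial (Fin m) R) where
  carrier := {f | ∀ v : Fin m →₀ ℕ, (¬∃ ν, v = n • ν) → (p : R) ∣ coeff v f}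
  mul_mem' := by
    intro f g hf hg v hv
    classical
    rw [coeff_mul]
    refine dvd_sum fun u hu => ?_
    rw [HasAntidiagonal.mem_antidiagonal] at hu
    by_cases h1 : ∃ ν, u.1 = n • ν
    · by_cases h2 : ∃ ν, u.2 = n • ν
      · obtain ⟨a, ha⟩ := h1
        obtain ⟨b, hb⟩ := h2
        exact absurd ⟨a + b, by rw [← hu, ha, hb, smul_add]⟩ hv
      · exact (hg _ h2).mul_left _
    · exact (hf _ h1).mul_right _
  add_mem' := by
    intro f g hf hg v hv
    rw [coeff_add]
    exact dvd_add (hf v hv) (hg v hv)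
  algebraMap_mem' := by
    intro r v hv
    classical
    rw [algebraMap_eq, coeff_C, if_neg]
    · exact dvd_zero _
    · rintro rfl
      exact hv ⟨0, (smul_zero n).symm⟩

/-- Since $p\mid\binom{p^s}{k}$ for $0<k<p^s$, the only generators that survive modulo $p$ are the
$e_n(y^a)$, which become $y^{na}$. -/
lemma dvd_coeff_rename_fst {p s : ℕ} (hp : p.Prime) (hn : n = p ^ s)
    {g : MvPolynomial (Fin m × Fin n) R} (hg : g ∈ invariants R n m) {v : Fin m →₀ ℕ}
    (hv : ¬∃ ν, v = n • ν) : (p : R) ∣ coeff v (rename Prod.fst g) := by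
  have hle : invariants R n m ≤ (divisibleOffMultiples R n m p).comap (rename Prod.fst) := by
    rw [← adjoin_primitiveGenerators]
    refine Algebra.adjoin_le ?_
    rintro _ ⟨a, k, -, hk, -, rfl⟩ v hv
    classical
    change (p : R) ∣ coeff v (rename Prod.fst (e n k (mon R a)))
    rw [rename_fst_e_mon, coeff_monomial]
    split_ifs with h
    · have hkn : k ≠ n := by
        rintro rfl
        exact hv ⟨a, h.symm⟩
      rw [hn] at hkn ⊢
      exact Nat.cast_dvd_cast (hp.dvd_choose_pow (by omega) hkn)
    · exact dvd_zero _
  exact hle hg v hv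

/-- Modulo $p$ only exponents $n\nu$ of `g` enter the convolution. By `hd` these are $0$ and
possibly `d`, and `d` meets the constant term of `X i * f`, which vanishes thanks to the factor `X
i`. -/
lemma dvd_coeff_mul_rename_fst {p s : ℕ} (hp : p.Prime) (hn : n = p ^ s) {d : Fin m →₀ ℕ}
    (hd : ∀ ν : Fin m →₀ ℕ, n • ν ≤ d → ν = 0 ∨ n • ν = d) (i : Fin m)
    {g : MvPolynomial (Fin m × Fin n) R} (hg : g ∈ invariants R n m)
    (f : MvPolynomial (Fin m) R) :
    (p : R) ∣ coeff d (rename Prod.fst g * (X i * f)) -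
      coeff 0 (rename Prod.fst g) * coeff d (X i * f) := by
  classical
  rw [coeff_mul, ← add_sum_erase _ _ (show (0, d) ∈ antidiagonal d by simp), add_sub_cancel_left]
  refine dvd_sum fun u hu => ?_
  rw [mem_erase, HasAntidiagonal.mem_antidiagonal] at hu
  by_cases h1 : ∃ ν, u.1 = n • ν
  · obtain ⟨ν, hν⟩ := h1
    rcases hd ν (by rw [← hν, ← hu.2]; exact le_self_add) with h | h
    · rw [h, smul_zero] at hν
      exact absurd (Prod.ext hν (by rw [← hu.2, hν, zero_add])) hu.1
    · rw [← hν] at h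
      have h2 : u.2 = 0 := by
        have := hu.2
        rwa [h, add_eq_left] at this
      rw [h2, show coeff 0 (X i * f) = 0 by simp [coeff_X_mul'], mul_zero]
      exact dvd_zero _
  · exact (dvd_coeff_rename_fst hp hn hg h1).mul_right _

/-- For suitable `d` and `n` a power of `p`, the invariants with `slotCoeff i j d g` divisible by
`p` form a subalgebra. -/
def slotCoeffKernel (R : Type*) [CommRing R] {n m p s : ℕ} (hp : p.Prime) (hn : n = p ^ s)
    {d : Fin m →₀ ℕ} (hd : ∀ ν : Fin m →₀ ℕ, n • ν ≤ d → ν = 0 ∨ n • ν = d)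
    (i : Fin m) (j : Fin n) : Subalgebra R (MvPolynomial (Fin m × Fin n) R) where
  carrier := {g | g ∈ invariants R n m ∧ (p : R) ∣ slotCoeff i j d g}
  mul_mem' := by
    rintro g h ⟨hg, hgp⟩ ⟨hh, hhp⟩
    refine ⟨mul_mem hg hh, ?_⟩
    rw [slotCoeff_apply] at hgp hhp ⊢
    have e1 : X i * rename Prod.fst (pderiv (i, j) (g * h)) =
        rename Prod.fst g * (X i * rename Prod.fst (pderiv (i, j) h)) +
        rename Prod.fst h * (X i * rename Prod.fst (pderiv (i, j) g)) := by
      rw [Derivation.leibniz]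
      simp only [smul_eq_mul, map_add, map_mul]
      ring
    rw [e1, coeff_add]
    exact dvd_add
      ((dvd_sub_left (hhp.mul_left _)).1 (dvd_coeff_mul_rename_fst hp hn hd i hg _))
      ((dvd_sub_left (hgp.mul_left _)).1 (dvd_coeff_mul_rename_fst hp hn hd i hh _))
  add_mem' := by
    rintro g h ⟨hg, hgp⟩ ⟨hh, hhp⟩
    exact ⟨add_mem hg hh, by rw [map_add]; exact dvd_add hgp hhp⟩
  algebraMap_mem' := by
    intro r
    refine ⟨Subalgebra.algebraMap_mem _ r, ?_⟩
    rw [slotCoeff_apply, Derivation.map_algebraMap]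
    simp

lemma degree_mapDomain_fst (α : Fin m × Fin n →₀ ℕ) : (α.mapDomain Prod.fst).degree = α.degree := by
  induction α using Finsupp.induction_linear with
  | zero => simp
  | add f g hf hg => simp [Finsupp.mapDomain_add, hf, hg]
  | single q b => simp [Finsupp.mapDomain_single]

lemma exists_coeff_ne_zero_of_slotCoeff_ne_zero {i : Fin m} {j : Fin n} {d : Fin m →₀ ℕ}
    {g : MvPolynomial (Fin m × Fin n) R} (h : slotCoeff i j d g ≠ 0) :
    ∃ α, coeff α g ≠ 0 ∧ α.mapDomain Prod.fst = d := by
  rw [g.as_sum, map_sum] at h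
  obtain ⟨α, hα, hne⟩ := exists_ne_zero_of_sum_ne_zero h
  refine ⟨α, mem_support_iff.1 hα, ?_⟩
  rw [← ofSlots_slots α, slotCoeff_monomial] at hne
  rw [← ofSlots_slots α, mapDomain_fst_ofSlots]
  by_contra hcon
  exact hne (if_neg hcon)

lemma card_filter_mem_powersetCard {ι : Type*} [DecidableEq ι] {s : Finset ι} {j : ι} (hj : j ∈ s)
    (k : ℕ) : #{J ∈ powersetCard (k + 1) s | j ∈ J} = (#s - 1).choose k := by
  simpa using card_filter_powersetCard_subset {j} s (k + 1) (by simpa using hj) (by simp)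

/-- Exactly the $\binom{n-1}{k}$ sets `J` through `j` contribute, each by `a i`. -/
lemma slotCoeff_e_mon (i : Fin m) (j : Fin n) (k : ℕ) (a : Fin m →₀ ℕ) :
    slotCoeff i j ((k + 1) • a) (e n (k + 1) (mon R a)) = (n - 1).choose k * a i := by
  have h : ∀ J ∈ powersetCard (k + 1) (univ : Finset (Fin n)),
      slotCoeff i j ((k + 1) • a) (monomial (ofSlots fun j => if j ∈ J then a else 0) (1 : R)) =
        if j ∈ J then (a i : R) else 0 := by
    intro J hJ
    rw [slotCoeff_monomial, if_pos]
    · split_ifs <;> simp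
    · rw [← (mem_powersetCard.1 hJ).2]
      simp
  rw [e_mon, map_sum, sum_congr rfl h, ← sum_filter, sum_const,
    card_filter_mem_powersetCard (mem_univ j), nsmul_eq_mul]
  simp

/-- A family of generators contains an element on which `slotCoeff` is not divisible by `p`. -/
lemma exists_generator_slotCoeff_ne_zero {p s : ℕ} (hp : p.Prime) (hn : n = p ^ s)
    {d : Fin m →₀ ℕ} (hd : ∀ ν : Fin m →₀ ℕ, n • ν ≤ d → ν = 0 ∨ n • ν = d)
    (i : Fin m) (j : Fin n) {G : Set (MvPolynomial (Fin m × Fin n) R)}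
    (hG : Algebra.adjoin R G = invariants R n m)
    {f : MvPolynomial (Fin m × Fin n) R} (hf : f ∈ invariants R n m)
    (hne : ¬(p : R) ∣ slotCoeff i j d f) : ∃ g ∈ G, slotCoeff i j d g ≠ 0 := by
  by_contra! hcon
  have hle : invariants R n m ≤ slotCoeffKernel R hp hn hd i j := by
    rw [← hG]
    refine Algebra.adjoin_le fun g hg => ⟨?_, ?_⟩
    · rw [← hG]
      exact Algebra.subset_adjoin hg
    · rw [hcon g hg]
      exact dvd_zero _
  exact hne (hle hf).2

lemma not_isUnit_natCast_prime [Nontrivial R] {p : ℕ} (hp : p.Prime)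
    (h : Nonempty (R ≃+* ℤ) ∨ (p : R) = 0) : ¬IsUnit (p : R) := by
  rcases h with ⟨⟨φ⟩⟩ | h
  · intro hu
    have := hu.map φ
    rw [map_natCast, Int.isUnit_iff_natAbs_eq, Int.natAbs_natCast] at this
    exact hp.one_lt.ne' this
  · rw [h]
    exact not_isUnit_zero

/-- For `n` a power of `p` and `p` not invertible, there are a multidegree of total degree
`bound n m` and an indecomposable invariant of that multidegree. -/
lemma exists_slotCoeff_of_bound {p s : ℕ} (hp : p.Prime) (hn : n = p ^ s) (hm : 1 ≤ m)
    (hu : ¬IsUnit (p : R)) :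
    ∃ (d : Fin m →₀ ℕ) (i : Fin m) (j : Fin n) (f : MvPolynomial (Fin m × Fin n) R),
      d.degree = bound n m ∧ (∀ ν : Fin m →₀ ℕ, n • ν ≤ d → ν = 0 ∨ n • ν = d) ∧
      f ∈ invariants R n m ∧ ¬(p : R) ∣ slotCoeff i j d f := by
  have hn1 : 1 ≤ n := hn ▸ Nat.one_le_pow _ _ hp.pos
  rcases le_total n (m * (n - 1)) with h | h
  · have hn2 : 2 ≤ n := by
      by_contra hcon
      have : n = 1 := by omega
      subst this
      simp at h
    obtain ⟨k, rfl⟩ : ∃ k, n = k + 2 := ⟨n - 2, by omega⟩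
    let a : Fin m →₀ ℕ := Finsupp.equivFunOnFinite.symm fun _ => 1
    have ha : ∀ i, a i = 1 := fun _ => rfl
    -- With $n=k+2$ the witness is $e_{n-1}(y_1\cdots y_m)$. Its value is $n-1\equiv-1$ modulo $p$,
    -- and every exponent of `d` is below $n$.
    refine ⟨(k + 1) • a, ⟨0, hm⟩, 0, e _ (k + 1) (mon R a), ?_, ?_, e_mem_invariants _ _, ?_⟩
    · rw [bound, max_eq_right h, Finsupp.degree_eq_sum]
      simp [ha]
    · intro ν hν
      left
      ext i
      have := hν i
      simp only [Finsupp.smul_apply, smul_eq_mul, ha, mul_one] at this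
      rw [Finsupp.zero_apply]
      by_contra h0
      nlinarith [Nat.pos_of_ne_zero h0]
    · rw [slotCoeff_e_mon, ha, Nat.add_sub_assoc (by norm_num), Nat.choose_succ_self_right]
      intro hdvd
      have hpn : (p : R) ∣ ((k + 2 : ℕ) : R) := by
        refine Nat.cast_dvd_cast ?_
        rw [hn]
        refine dvd_pow_self p ?_
        rintro rfl
        simp at hn
      have := dvd_sub hpn (show (p : R) ∣ ((k + 1 : ℕ) : R) by simpa using hdvd)
      refine hu (isUnit_iff_dvd_one.2 ?_)
      convert this using 1
      push_cast
      ring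
  · obtain ⟨k, rfl⟩ : ∃ k, n = k + 1 := ⟨n - 1, by omega⟩
    let i : Fin m := ⟨0, hm⟩
    -- With $n=k+1$ the witness is $e_n(y_1)$, of value $\binom{n-1}{n-1}=1$.
    refine ⟨(k + 1) • Finsupp.single i 1, i, 0, e _ (k + 1) (mon R (Finsupp.single i 1)), ?_, ?_,
      e_mem_invariants _ _, ?_⟩
    · rw [bound, max_eq_left h]
      simp
    · intro ν hν
      have hν : ν ≤ Finsupp.single i 1 := fun l => by
        have := hν l
        simp only [Finsupp.smul_apply, smul_eq_mul] at this
        exact Nat.le_of_mul_le_mul_left this (Nat.succ_pos k)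
      by_cases h0 : ν i = 0
      · left
        ext l
        by_cases hl : l = i
        · rw [hl, h0]; rfl
        · have := hν l
          rw [Finsupp.single_eq_of_ne hl] at this
          simpa using this
      · right
        congr 1
        refine le_antisymm hν ?_
        rw [Finsupp.single_le_iff]
        omega
    · rw [slotCoeff_e_mon]
      simpa [isUnit_iff_dvd_one] using hu

theorem bound_attained {p s : ℕ} (hp : p.Prime) (hn : n = p ^ s) (hm : 1 ≤ m) [Nontrivial R]
    (h : Nonempty (R ≃+* ℤ) ∨ (p : R) = 0) (G : Set (MvPolynomial (Fin m × Fin n) R))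
    (hG : Algebra.adjoin R G = invariants R n m) :
    (∃ g ∈ G, bound n m ≤ g.totalDegree) ∧
      ((∀ g ∈ G, ∃ d : ℕ, g.IsHomogeneous d) → ∃ g ∈ G, g.totalDegree = bound n m) := by
  obtain ⟨d, i, j, f, hdeg, hd, hf, hne⟩ :=
    exists_slotCoeff_of_bound (R := R) hp hn hm (not_isUnit_natCast_prime hp h)
  obtain ⟨g, hg, hgne⟩ := exists_generator_slotCoeff_ne_zero hp hn hd i j hG hf hne
  obtain ⟨α, hα, hαd⟩ := exists_coeff_ne_zero_of_slotCoeff_ne_zero hgne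
  have hαdeg : α.degree = bound n m := by rw [← hdeg, ← hαd, degree_mapDomain_fst]
  refine ⟨⟨g, hg, hαdeg ▸ ?_⟩, fun hhom => ⟨g, hg, ?_⟩⟩
  · rw [Finsupp.degree_apply]
    exact le_totalDegree (mem_support_iff.2 hα)
  · obtain ⟨c, hc⟩ := hhom g hg
    rw [hc.totalDegree (fun h0 => hα (by rw [h0, coeff_zero])), ← hαdeg]
    exact (hc.coeff_eq_zero.mt hα |> not_not.1).symm

end SlotCoefficient

end Multisymmetric

namespace Multisymmetric

open MvPolynomial Finset

/-! ### Primitive exponent vectors -/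

section Primitive

variable {m : ℕ}

lemma IsPrimitive.gcd_eq_one {a : Fin m →₀ ℕ} (ha : IsPrimitive a) : univ.gcd a = 1 := by
  have hdvd : ∀ i, univ.gcd a ∣ a i := fun i => gcd_dvd (mem_univ i)
  choose b hb using hdvd
  have hab : a = univ.gcd a • (Finsupp.equivFunOnFinite.symm b) := by
    ext i
    simpa using hb i
  have h := ha.2 _ _ hab
  rw [h] at hab
  obtain ⟨i, hi⟩ := Finsupp.ne_iff.1 ha.1
  have h1 := DFunLike.congr_fun hab i
  rw [Finsupp.smul_apply, smul_eq_mul] at h1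
  rw [Finsupp.zero_apply] at hi
  exact Nat.eq_of_mul_eq_mul_right (Nat.pos_of_ne_zero hi) (by omega)

lemma IsPrimitive.exists_not_dvd {a : Fin m →₀ ℕ} (ha : IsPrimitive a) {p : ℕ} (hp : p.Prime) :
    ∃ i, ¬p ∣ a i := by
  by_contra! hcon
  have h : p ∣ univ.gcd a := dvd_gcd fun i _ => hcon i
  rw [ha.gcd_eq_one] at h
  exact hp.one_lt.ne' (Nat.dvd_one.1 h)

/-- The gcd of the entries of `k • a` is `k` when `a` is primitive. -/
lemma IsPrimitive.nsmul_inj {a b : Fin m →₀ ℕ} (ha : IsPrimitive a) (hb : IsPrimitive b)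
    {k l : ℕ} (hk : 1 ≤ k) (h : k • a = l • b) : k = l ∧ a = b := by
  have h1 : ∀ i, k * a i = l * b i := fun i => by
    simpa using DFunLike.congr_fun h i
  have h2 := gcd_mul_left (s := (univ : Finset (Fin m))) (f := a) (a := k)
  have h3 := gcd_mul_left (s := (univ : Finset (Fin m))) (f := b) (a := l)
  simp_rw [h1] at h2
  rw [h3, ha.gcd_eq_one, hb.gcd_eq_one] at h2
  have hkl : k = l := by simpa using h2.symm
  subst hkl
  refine ⟨rfl, ?_⟩
  ext i
  exact Nat.eq_of_mul_eq_mul_left hk (h1 i)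

end Primitive

/-! ### Multidegrees and decomposable invariants -/

section Multidegree

variable {R : Type*} [CommRing R] {n m : ℕ}

/-- The weights for the multidegree: `x_i(j)` has multidegree `y_i`. -/
noncomputable def multiweight (n m : ℕ) (q : Fin m × Fin n) : Fin m →₀ ℕ := Finsupp.single q.1 1

lemma weight_multiweight (α : Fin m × Fin n →₀ ℕ) :
    Finsupp.weight (multiweight n m) α = α.mapDomain Prod.fst := by
  induction α using Finsupp.induction_linear with
  | zero => simp
  | add f g hf hg => simp [Finsupp.mapDomain_add, hf, hg]
  | single q b => simp [Finsupp.weight_single, Finsupp.mapDomain_single, multiweight]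

lemma isWeightedHomogeneous_monomial_ofSlots (β : Fin n → Fin m →₀ ℕ) (r : R) :
    IsWeightedHomogeneous (multiweight n m) (monomial (ofSlots β) r) (∑ j, β j) :=
  isWeightedHomogeneous_monomial _ _ _ (by rw [weight_multiweight, mapDomain_fst_ofSlots])

lemma isWeightedHomogeneous_e_mon (k : ℕ) (a : Fin m →₀ ℕ) :
    IsWeightedHomogeneous (multiweight n m) (e n k (mon R a)) (k • a) := by
  rw [e_mon]
  refine IsWeightedHomogeneous.sum _ _ _ fun J hJ => ?_
  convert isWeightedHomogeneous_monomial_ofSlots _ _ using 1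
  rw [← (mem_powersetCard.1 hJ).2]
  simp

lemma slotCoeff_eq_zero_of_isWeightedHomogeneous {i : Fin m} {j : Fin n} {d u : Fin m →₀ ℕ}
    {g : MvPolynomial (Fin m × Fin n) R} (hg : IsWeightedHomogeneous (multiweight n m) g u)
    (hne : u ≠ d) : slotCoeff i j d g = 0 := by
  by_contra h
  obtain ⟨α, hα, hαd⟩ := exists_coeff_ne_zero_of_slotCoeff_ne_zero h
  exact hne (by rw [← hαd, ← weight_multiweight, hg hα])

/-- The subalgebra generated by the `e_k(μ)` with `μ` primitive and `k l(μ) < D`. -/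
noncomputable def lowDegree (R : Type*) [CommRing R] (n m D : ℕ) :
    Subalgebra R (MvPolynomial (Fin m × Fin n) R) :=
  Algebra.adjoin R {g | ∃ (a : Fin m →₀ ℕ) (k : ℕ), IsPrimitive a ∧ 1 ≤ k ∧ k * a.degree < D ∧
    g = e n k (mon R a)}

lemma lowDegree_mono {D D' : ℕ} (h : D ≤ D') : lowDegree R n m D ≤ lowDegree R n m D' := by
  refine Algebra.adjoin_mono ?_
  rintro _ ⟨a, k, ha, hk, hd, rfl⟩
  exact ⟨a, k, ha, hk, hd.trans_le h, rfl⟩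

/-- In a product of two factors other than $1$, both have positive degree, so each has degree below
the total. -/
lemma closure_primitiveGenerators_cases {g : MvPolynomial (Fin m × Fin n) R}
    (hg : g ∈ Submonoid.closure (primitiveGenerators R n m)) :
    ∃ u, IsWeightedHomogeneous (multiweight n m) g u ∧ (g = 1 ∨ u ≠ 0 ∧
      ((∃ a k, IsPrimitive a ∧ 1 ≤ k ∧ u = k • a ∧ g = e n k (mon R a)) ∨
        g ∈ lowDegree R n m u.degree)) := by
  induction hg using Submonoid.closure_induction with
  | mem g hg =>
    obtain ⟨a, k, ha, hk, -, rfl⟩ := hg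
    exact ⟨k • a, isWeightedHomogeneous_e_mon k a, Or.inr
      ⟨smul_ne_zero (by omega) ha.1, Or.inl ⟨a, k, ha, hk, rfl, rfl⟩⟩⟩
  | one => exact ⟨0, isWeightedHomogeneous_one _ _, Or.inl rfl⟩
  | mul g h _ _ ihg ihh =>
    obtain ⟨u, hu, hgu⟩ := ihg
    obtain ⟨v, hv, hhv⟩ := ihh
    rcases hgu with rfl | ⟨hu0, hgu⟩
    · exact ⟨v, by rwa [one_mul], by rwa [one_mul]⟩
    rcases hhv with rfl | ⟨hv0, hhv⟩
    · exact ⟨u, by rwa [mul_one], by rw [mul_one]; exact Or.inr ⟨hu0, hgu⟩⟩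
    have low : ∀ {w : Fin m →₀ ℕ} {f : MvPolynomial (Fin m × Fin n) R}, w.degree < (u + v).degree →
        ((∃ a k, IsPrimitive a ∧ 1 ≤ k ∧ w = k • a ∧ f = e n k (mon R a)) ∨
          f ∈ lowDegree R n m w.degree) → f ∈ lowDegree R n m (u + v).degree := by
      rintro w f hw (⟨a, k, ha, hk, rfl, rfl⟩ | hf)
      · exact Algebra.subset_adjoin ⟨a, k, ha, hk, by simpa using hw, rfl⟩
      · exact lowDegree_mono hw.le hf
    have hu1 : u.degree ≠ 0 := by rwa [Ne, Finsupp.degree_eq_zero_iff]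
    have hv1 : v.degree ≠ 0 := by rwa [Ne, Finsupp.degree_eq_zero_iff]
    have hadd : (u + v).degree = u.degree + v.degree := map_add _ _ _
    refine ⟨u + v, hu.mul hv, Or.inr ⟨fun h0 => ?_, Or.inr (mul_mem (low ?_ hgu) (low ?_ hhv))⟩⟩
    · rw [h0, map_zero] at hadd
      omega
    · omega
    · omega

/-- An invariant of multidegree `k • a`, with `a` primitive, is a multiple of `e_k(y^a)` up to
decomposable invariants. -/
lemma exists_eq_smul_e_add {a : Fin m →₀ ℕ} (ha : IsPrimitive a) {k : ℕ} (hk : 1 ≤ k)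
    {f : MvPolynomial (Fin m × Fin n) R} (hf : f ∈ invariants R n m)
    (hfd : IsWeightedHomogeneous (multiweight n m) f (k • a)) :
    ∃ (c : R) (f' : MvPolynomial (Fin m × Fin n) R), f' ∈ lowDegree R n m (k * a.degree) ∧
      f = c • e n k (mon R a) + f' := by
  classical
  -- Invariants are combinations of products of generators. Among single generators, the projection
  -- to multidegree `k • a` keeps only $e_k(y^a)$.
  have hle : Submodule.span R (Submonoid.closure (primitiveGenerators R n m) : Set _) ≤
      (Submodule.span R {e n k (mon R a)} ⊔
        Subalgebra.toSubmodule (lowDegree R n m (k * a.degree))).comap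
          (weightedHomogeneousComponent (multiweight n m) (k • a)) := by
    refine Submodule.span_le.2 fun g hg => ?_
    obtain ⟨u, hu, hcases⟩ := closure_primitiveGenerators_cases hg
    rw [SetLike.mem_coe, Submodule.mem_comap]
    by_cases hud : u = k • a
    · subst hud
      rw [hu.weightedHomogeneousComponent_same]
      rcases hcases with rfl | ⟨-, ⟨b, l, hb, -, hbl, rfl⟩ | hlow⟩
      · exact Submodule.mem_sup_right (one_mem (lowDegree R n m (k * a.degree)))
      · obtain ⟨rfl, rfl⟩ := ha.nsmul_inj hb hk hbl
        exact Submodule.mem_sup_left (Submodule.mem_span_singleton_self _)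
      · refine Submodule.mem_sup_right ?_
        simpa using hlow
    · rw [hu.weightedHomogeneousComponent_ne _ (Ne.symm hud)]
      exact zero_mem _
  rw [← Algebra.adjoin_eq_span, adjoin_primitiveGenerators] at hle
  have hmem := hle hf
  rw [Submodule.mem_comap, hfd.weightedHomogeneousComponent_same, Submodule.mem_sup] at hmem
  obtain ⟨y, hy, f', hf', rfl⟩ := hmem
  obtain ⟨c, rfl⟩ := Submodule.mem_span_singleton.1 hy
  exact ⟨c, f', hf', rfl⟩

end Multidegree

/-! ### Invariants with two kinds of filled slots -/

section TwoPart

variable {R : Type*} [CommRing R] {n m : ℕ}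

/-- The exponents with `ζ` on `K` and `x` on `U \ K`. -/
noncomputable def twoPartSlots (x ζ : Fin m →₀ ℕ) (U K : Finset (Fin n)) (j : Fin n) :
    Fin m →₀ ℕ :=
  if j ∈ K then ζ else if j ∈ U then x else 0

/-- The sum of the monomials that carry `x` at `c` indices and `ζ` at `q` other indices. -/
noncomputable def twoPart (R : Type*) [CommRing R] (n : ℕ) {m : ℕ} (c q : ℕ)
    (x ζ : Fin m →₀ ℕ) : MvPolynomial (Fin m × Fin n) R :=
  ∑ U ∈ powersetCard (c + q) univ, ∑ K ∈ powersetCard q U,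
    monomial (ofSlots (twoPartSlots x ζ U K)) 1

lemma twoPart_mem_invariants (c q : ℕ) (x ζ : Fin m →₀ ℕ) :
    twoPart R n c q x ζ ∈ invariants R n m := by
  intro σ
  simp_rw [twoPart, map_sum]
  refine sum_equiv σ.finsetCongr (by simp) fun U _ => ?_
  refine sum_equiv σ.finsetCongr (by simp [mem_powersetCard]) fun K _ => ?_
  have h : twoPartSlots x ζ U K =
      twoPartSlots x ζ (σ.finsetCongr U) (σ.finsetCongr K) ∘ σ := by
    funext j
    simp [twoPartSlots]
  rw [h, rename_perm_monomial]

lemma sum_twoPartSlots {c q : ℕ} (x ζ : Fin m →₀ ℕ) {U K : Finset (Fin n)} (hU : #U = c + q)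
    (hK : K ∈ powersetCard q U) : ∑ j, twoPartSlots x ζ U K j = c • x + q • ζ := by
  rw [mem_powersetCard] at hK
  have h : ∀ j, twoPartSlots x ζ U K j =
      (if j ∈ U \ K then x else 0) + if j ∈ K then ζ else 0 := by
    intro j
    by_cases h1 : j ∈ K <;> simp [twoPartSlots, h1]
  simp_rw [h, sum_add_distrib]
  have hc : #(U \ K) = c := by
    rw [card_sdiff_of_subset hK.1]
    omega
  rw [sum_ite_mem, sum_ite_mem, univ_inter, univ_inter, sum_const, sum_const, hc, hK.2]

lemma isWeightedHomogeneous_twoPart (c q : ℕ) (x ζ : Fin m →₀ ℕ) :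
    IsWeightedHomogeneous (multiweight n m) (twoPart R n c q x ζ) (c • x + q • ζ) := by
  refine IsWeightedHomogeneous.sum _ _ _ fun U hU => IsWeightedHomogeneous.sum _ _ _ fun K hK => ?_
  rw [← sum_twoPartSlots x ζ (mem_powersetCard.1 hU).2 hK]
  exact isWeightedHomogeneous_monomial_ofSlots _ _

/-- Only the `U` through `j` count; for these, each `K` containing `j` contributes `ζ i` and every
other `K` contributes `x i`. -/
lemma slotCoeff_twoPart (i : Fin m) (j : Fin n) (c q : ℕ) (x ζ : Fin m →₀ ℕ) :
    slotCoeff i j (c • x + (q + 1) • ζ) (twoPart R n c (q + 1) x ζ) =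
      (n - 1).choose (c + q) * ((c + q).choose q * ζ i + (c + q).choose (q + 1) * x i) := by
  have h1 : ∀ U ∈ powersetCard (c + (q + 1)) (univ : Finset (Fin n)),
      ∑ K ∈ powersetCard (q + 1) U, slotCoeff i j (c • x + (q + 1) • ζ)
        (monomial (ofSlots (twoPartSlots x ζ U K)) (1 : R)) =
      if j ∈ U then ((c + q).choose q * ζ i + (c + q).choose (q + 1) * x i : R) else 0 := by
    intro U hU
    have hUc := (mem_powersetCard.1 hU).2
    have h2 : ∀ K ∈ powersetCard (q + 1) U, slotCoeff i j (c • x + (q + 1) • ζ)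
        (monomial (ofSlots (twoPartSlots x ζ U K)) (1 : R)) =
        if j ∈ K then (ζ i : R) else if j ∈ U then (x i : R) else 0 := by
      intro K hK
      rw [slotCoeff_monomial, if_pos (sum_twoPartSlots x ζ hUc hK), twoPartSlots]
      split_ifs <;> simp
    rw [sum_congr rfl h2]
    split_ifs with hj
    · have h3 := card_filter_mem_powersetCard hj q
      have h4 := card_filter_add_card_filter_not (s := powersetCard (q + 1) U) (fun K => j ∈ K)
      rw [card_powersetCard, hUc, ← add_assoc, Nat.choose_succ_succ, h3, hUc,
        ← add_assoc, Nat.add_sub_cancel, add_right_inj] at h4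
      rw [sum_ite, sum_const, sum_const, h3, h4, hUc, ← add_assoc, Nat.add_sub_cancel,
        nsmul_eq_mul, nsmul_eq_mul]
    · refine sum_eq_zero fun K hK => if_neg fun h => hj ((mem_powersetCard.1 hK).1 h)
  simp_rw [twoPart, map_sum]
  rw [sum_congr rfl h1, ← sum_filter, sum_const, ← add_assoc,
    card_filter_mem_powersetCard (mem_univ j), card_univ, Fintype.card_fin, nsmul_eq_mul]

end TwoPart

/-! ### Reducing the number of slots -/

section Restriction

variable {R : Type*} [CommRing R] {n n' m : ℕ}

/-- The map that sets the variables `x_i(j)` with `j > n` to zero. -/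
noncomputable def restrictSlots (R : Type*) [CommRing R] (n n' m : ℕ) :
    MvPolynomial (Fin m × Fin n') R →ₐ[R] MvPolynomial (Fin m × Fin n) R :=
  aeval fun q => if h : q.2.1 < n then X (q.1, ⟨q.2.1, h⟩) else 0

lemma restrictSlots_at_of_lt (f : MvPolynomial (Fin m) R) {j : Fin n'} (h : j.1 < n) :
    restrictSlots R n n' m (at_ f j) = at_ f ⟨j.1, h⟩ := by
  have hc : (restrictSlots R n n' m).comp
      (aeval (fun i : Fin m => (X (i, j) : MvPolynomial (Fin m × Fin n') R))) =
      aeval (fun i : Fin m => (X (i, ⟨j.1, h⟩) : MvPolynomial (Fin m × Fin n) R)) := by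
    ext i
    simp [restrictSlots, h]
  exact DFunLike.congr_fun hc f

lemma restrictSlots_at_mon_of_le {a : Fin m →₀ ℕ} (ha : a ≠ 0) {j : Fin n'} (h : n ≤ j.1) :
    restrictSlots R n n' m (at_ (mon R a) j) = 0 := by
  obtain ⟨i, hi⟩ := Finsupp.ne_iff.1 ha
  rw [Finsupp.zero_apply] at hi
  rw [at_mon, restrictSlots, aeval_monomial, Finsupp.prod, map_one, one_mul]
  refine prod_eq_zero (i := (i, j)) (by simpa using hi) ?_
  simp [hi, h.not_gt]

lemma monomial_ofSlots_eq_prod (β : Fin n → Fin m →₀ ℕ) :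
    monomial (ofSlots β) (1 : R) = ∏ j, at_ (mon R (β j)) j := by
  simp_rw [at_mon]
  rw [← monomial_sum_one, sum_ofSlots]
  simp

lemma restrictSlots_e_mon (hn : n ≤ n') (k : ℕ) {a : Fin m →₀ ℕ} (ha : a ≠ 0) :
    restrictSlots R n n' m (e n' k (mon R a)) = e n k (mon R a) := by
  rw [e_eq_sum, e_eq_sum, map_sum]
  have hsub : powersetCard k (univ.map (Fin.castLEEmb hn)) ⊆ powersetCard k (univ : Finset (Fin n')) :=
    powersetCard_mono (subset_univ _)
  rw [← sum_subset hsub, powersetCard_map, sum_map]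
  · refine sum_congr rfl fun J _ => ?_
    simp only [RelEmbedding.coe_toEmbedding, mapEmbedding_apply, prod_map, map_prod]
    refine prod_congr rfl fun j _ => ?_
    rw [restrictSlots_at_of_lt (h := by simp)]
    rfl
  · intro J hJ hJn
    rw [mem_powersetCard] at hJ hJn
    have : ¬J ⊆ univ.map (Fin.castLEEmb hn) := fun h => hJn ⟨h, hJ.2⟩
    obtain ⟨j, hj, hjn⟩ := not_subset.1 this
    rw [map_prod]
    refine prod_eq_zero hj (restrictSlots_at_mon_of_le ha ?_)
    by_contra! hlt
    exact hjn (mem_map.2 ⟨⟨j.1, hlt⟩, mem_univ _, by ext; simp⟩)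

lemma restrictSlots_twoPart {c q : ℕ} {x ζ : Fin m →₀ ℕ} (hx : x ≠ 0) (hζ : ζ ≠ 0)
    (h : n < c + q) : restrictSlots R n n' m (twoPart R n' c q x ζ) = 0 := by
  simp_rw [twoPart, map_sum]
  refine sum_eq_zero fun U hU => sum_eq_zero fun K _ => ?_
  have hex : ∃ j ∈ U, n ≤ j.1 := by
    by_contra! hcon
    have h1 : #U ≤ #(range n) := card_le_card_of_injOn (fun j => j.1)
      (fun j hj => by simpa using hcon j hj) (fun j _ l _ hjl => Fin.ext hjl)
    rw [(mem_powersetCard.1 hU).2, card_range] at h1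
    omega
  obtain ⟨j, hjU, hj⟩ := hex
  rw [monomial_ofSlots_eq_prod, map_prod]
  refine prod_eq_zero (mem_univ j) (restrictSlots_at_mon_of_le ?_ hj)
  rw [twoPartSlots, if_pos hjU]
  split_ifs <;> assumption

lemma restrictSlots_mem_lowDegree (hn : n ≤ n') {D : ℕ} {f : MvPolynomial (Fin m × Fin n') R}
    (hf : f ∈ lowDegree R n' m D) : restrictSlots R n n' m f ∈ lowDegree R n m D := by
  have hle : lowDegree R n' m D ≤ (lowDegree R n m D).comap (restrictSlots R n n' m) := by
    refine Algebra.adjoin_le ?_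
    rintro _ ⟨a, k, ha, hk, hd, rfl⟩
    refine Subalgebra.mem_comap .. |>.2 ?_
    rw [restrictSlots_e_mon hn k ha.1]
    exact Algebra.subset_adjoin ⟨a, k, ha, hk, hd, rfl⟩
  exact hle hf

end Restriction

/-! ### Binomial coefficients prime to $p$ -/

section Binomials

/-- By Pascal's rule consecutive entries of row $p^s-1$ add up to $\binom{p^s}{j+1}\equiv0$, so
non-divisibility propagates from $j=0$. -/
lemma not_dvd_choose_pow_sub_one {p : ℕ} (hp : p.Prime) (s : ℕ) {j : ℕ} (hj : j < p ^ s) :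
    ¬p ∣ (p ^ s - 1).choose j := by
  induction j with
  | zero => simpa using hp.one_lt.ne'
  | succ j ih =>
    intro hdvd
    refine ih (by omega) ?_
    have h := hp.dvd_choose_pow (n := s) (k := j + 1) (by omega) (by omega)
    obtain ⟨t, ht⟩ : ∃ t, p ^ s = t + 1 := ⟨p ^ s - 1, by omega⟩
    rw [ht, Nat.choose_succ_succ] at h
    rw [ht, Nat.add_sub_cancel] at hdvd ⊢
    exact (Nat.dvd_add_left hdvd).1 h

/-- Lucas' theorem: for $v\ge1$ both arguments have last base-$p$ digit $p-1$, and deleting it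
lowers $v$ by one. -/
lemma not_dvd_choose_pow_mul_sub_one {p : ℕ} (hp : p.Prime) (v w : ℕ) :
    ¬p ∣ (p ^ v * (w + 1) - 1).choose (p ^ v - 1) := by
  induction v with
  | zero => simpa using hp.one_lt.ne'
  | succ v ih =>
    have := Fact.mk hp
    have hsplit : ∀ t, 1 ≤ t → (p * t - 1) % p = p - 1 ∧ (p * t - 1) / p = t - 1 := by
      intro t ht
      obtain ⟨t, rfl⟩ : ∃ u, t = u + 1 := ⟨t - 1, by omega⟩
      have hpt : p * (t + 1) - 1 = (p - 1) + p * t := by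
        have := hp.pos
        rw [mul_add, mul_one]
        omega
      have hlt : p - 1 < p := Nat.sub_lt hp.pos one_pos
      rw [hpt, Nat.add_mul_mod_self_left, Nat.mod_eq_of_lt hlt,
        Nat.add_mul_div_left _ _ hp.pos, Nat.div_eq_of_lt hlt]
      simp
    have hpv : 1 ≤ p ^ v := Nat.one_le_pow _ _ hp.pos
    have h1 := hsplit (p ^ v * (w + 1)) (Nat.mul_pos hpv (Nat.succ_pos w))
    have h2 := hsplit (p ^ v) hpv
    have h := Choose.choose_modEq_choose_mod_mul_choose_div_nat
      (n := p * (p ^ v * (w + 1)) - 1) (k := p * p ^ v - 1) (p := p)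
    rw [h1.1, h1.2, h2.1, h2.2, Nat.choose_self, one_mul] at h
    rw [pow_succ', mul_assoc, h.dvd_iff dvd_rfl]
    exact ih

end Binomials

end Multisymmetric

namespace Multisymmetric

open MvPolynomial Finset

/-! ### The degree bound over $\mathbb Z$ and base change -/

section DegreeBound

variable {R : Type*} [CommRing R] {n m : ℕ}

/-- The invariants of low degree lie in the kernel of `slotCoeff` modulo `p`. -/
lemma dvd_slotCoeff_of_mem_lowDegree {p s : ℕ} (hp : p.Prime) (hn : n = p ^ s) {d : Fin m →₀ ℕ}
    (hd : ∀ ν : Fin m →₀ ℕ, n • ν ≤ d → ν = 0 ∨ n • ν = d) (i : Fin m) (j : Fin n)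
    {f : MvPolynomial (Fin m × Fin n) R} (hf : f ∈ lowDegree R n m d.degree) :
    (p : R) ∣ slotCoeff i j d f := by
  have hle : lowDegree R n m d.degree ≤ slotCoeffKernel R hp hn hd i j := by
    refine Algebra.adjoin_le ?_
    rintro _ ⟨a, k, -, -, hk, rfl⟩
    refine ⟨e_mem_invariants _ _, ?_⟩
    rw [slotCoeff_eq_zero_of_isWeightedHomogeneous (isWeightedHomogeneous_e_mon k a)]
    · exact dvd_zero _
    · rintro rfl
      simp at hk
  exact (hle hf).2

lemma smul_single_add_smul_erase (a : Fin m →₀ ℕ) (i₀ : Fin m) (q k' : ℕ) :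
    (q * (k' * a i₀)) • Finsupp.single i₀ 1 + q • (k' • a.erase i₀) = (q * k') • a := by
  ext i
  by_cases hi : i = i₀
  · subst hi
    simp [mul_assoc]
  · simp [Finsupp.single_eq_of_ne hi, Finsupp.erase_ne hi, mul_assoc]

/-- If `y^a` involves more than one variable and `n ≤ k * a i₀`, then for every prime `p` some
multiple of `e_k(y^a)` by an integer prime to `p` is decomposable. -/
lemma exists_smul_e_mem_lowDegree {a : Fin m →₀ ℕ} (ha : IsPrimitive a) {k : ℕ} (hk : 1 ≤ k)
    {i₀ : Fin m} (hn1 : 1 ≤ n) (hn : n ≤ k * a i₀) (hb : a.erase i₀ ≠ 0) {p : ℕ} (hp : p.Prime) :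
    ∃ c : ℤ, ¬(p : ℤ) ∣ c ∧ c • e n k (mon ℤ a) ∈ lowDegree ℤ n m (k * a.degree) := by
  obtain ⟨v, k', hpk', rfl⟩ := Nat.exists_eq_pow_mul_and_not_dvd (n := k) (by omega) p hp.ne_one
  obtain ⟨q, hq⟩ : ∃ q, p ^ v = q + 1 := ⟨p ^ v - 1, by have := Nat.pow_pos (n := v) hp.pos; omega⟩
  set w := k' * a i₀ with hw
  -- This makes $p^s$ exceed $n$, the number of occupied slots and the degree of the multidegree, so
  -- that `hd` leaves only $\nu=0$.
  set s := p ^ v * w + p ^ v + (p ^ v * k') * a.degree + n with hs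
  have hps : s < p ^ s := Nat.lt_pow_self hp.one_lt
  have hk'0 : k' ≠ 0 := by
    rintro rfl
    exact hpk' (dvd_zero p)
  have hd : ∀ ν : Fin m →₀ ℕ, p ^ s • ν ≤ (p ^ v * k') • a → ν = 0 ∨ p ^ s • ν = (p ^ v * k') • a := by
    intro ν hν
    left
    ext i
    rw [Finsupp.zero_apply]
    by_contra h0
    have h1 := hν i
    simp only [Finsupp.smul_apply, smul_eq_mul] at h1
    have h2 : p ^ s ≤ p ^ s * ν i := Nat.le_mul_of_pos_right _ (Nat.pos_of_ne_zero h0)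
    have h3 : (p ^ v * k') * a i ≤ (p ^ v * k') * a.degree :=
      Nat.mul_le_mul_left _ (Finsupp.le_degree i a)
    omega
  have hx : (Finsupp.single i₀ 1 : Fin m →₀ ℕ) ≠ 0 := by simp
  have hζ : k' • a.erase i₀ ≠ 0 := smul_ne_zero hk'0 hb
  have hdeg := smul_single_add_smul_erase a i₀ (p ^ v) k'
  rw [← hw] at hdeg
  obtain ⟨c, f', hf', hcf⟩ := exists_eq_smul_e_add (R := ℤ) ha hk
    (twoPart_mem_invariants (n := p ^ s) (p ^ v * w) (p ^ v) (Finsupp.single i₀ 1)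
      (k' • a.erase i₀))
    (by rw [← hdeg]; exact isWeightedHomogeneous_twoPart _ _ _ _)
  refine ⟨c, fun hpc => ?_, ?_⟩
  -- If $p\mid c$, then `slotCoeff` of `twoPart` is divisible by $p$; but up to a factor prime to
  -- $p$ its value is $k'a_i$.
  · obtain ⟨i, hi⟩ := ha.exists_not_dvd hp
    have hfp := dvd_slotCoeff_of_mem_lowDegree hp rfl hd i ⟨0, by omega⟩
      (f := f') (by simpa using hf')
    have hdvd : (p : ℤ) ∣ slotCoeff i (⟨0, by omega⟩ : Fin (p ^ s)) ((p ^ v * k') • a)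
        (twoPart ℤ (p ^ s) (p ^ v * w) (p ^ v) (Finsupp.single i₀ 1) (k' • a.erase i₀)) := by
      rw [hcf, map_add, map_smul, smul_eq_mul]
      exact dvd_add (hpc.mul_right _) hfp
    have hB := not_dvd_choose_pow_mul_sub_one hp v w
    have hBe : p ^ v * (w + 1) - 1 = p ^ v * w + q := by rw [mul_add, mul_one]; omega
    rw [hBe, show p ^ v - 1 = q by omega] at hB
    have hA := not_dvd_choose_pow_sub_one hp s (j := p ^ v * w + q) (by omega)
    rw [← hdeg] at hdvd
    have hval := slotCoeff_twoPart (R := ℤ) i (⟨0, by omega⟩ : Fin (p ^ s)) (p ^ v * w) q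
      (Finsupp.single i₀ 1) (k' • a.erase i₀)
    rw [← hq] at hval
    rw [hval] at hdvd
    have hdvd' : p ∣ (p ^ s - 1).choose (p ^ v * w + q) *
        ((p ^ v * w + q).choose q * (k' • a.erase i₀) i +
          (p ^ v * w + q).choose (p ^ v) * Finsupp.single i₀ 1 i) := by
      exact_mod_cast hdvd
    have h1 := (hp.dvd_mul.1 hdvd').resolve_left hA
    have hki : ¬p ∣ k' * a i := fun h => (hp.dvd_mul.1 h).elim hpk' hi
    by_cases hii : i = i₀
    · subst hii
      -- Cancelling $p^v=q+1$ turns $\binom{p^vw+q}{p^v}$ into $\binom{p^vw+q}{q}\,w$, and $w=k'a_i$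
      -- here.
      have hch := Nat.choose_succ_right_eq (p ^ v * w + q) q
      rw [← hq, Nat.add_sub_cancel] at hch
      have hch' : p ^ v * (p ^ v * w + q).choose (p ^ v) =
          p ^ v * ((p ^ v * w + q).choose q * w) := by
        rw [mul_comm, hch]
        ring
      rw [Nat.eq_of_mul_eq_mul_left (by omega) hch'] at h1
      simp only [Finsupp.smul_apply, Finsupp.erase_same, smul_zero, mul_zero, zero_add,
        Finsupp.single_eq_same, mul_one] at h1
      exact (hp.dvd_mul.1 h1).elim hB hki
    · rw [Finsupp.single_eq_of_ne hii, mul_zero, add_zero, Finsupp.smul_apply,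
        Finsupp.erase_ne hii, smul_eq_mul] at h1
      exact (hp.dvd_mul.1 h1).elim hB hki
  -- `twoPart` occupies $k\,a_{i_0}+p^v>n$ slots, so it restricts to zero.
  · have h := congrArg (restrictSlots ℤ n (p ^ s) m) hcf
    rw [restrictSlots_twoPart hx hζ (by rw [hw, ← mul_assoc]; omega), map_add, map_smul,
      restrictSlots_e_mon (by omega) _ ha.1] at h
    rw [eq_neg_of_add_eq_zero_left h.symm]
    exact neg_mem (restrictSlots_mem_lowDegree (by omega) hf')

lemma ideal_eq_top_of_forall_prime {I : Ideal ℤ}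
    (h : ∀ p : ℕ, p.Prime → ∃ c : ℤ, ¬(p : ℤ) ∣ c ∧ c ∈ I) : I = ⊤ := by
  obtain ⟨g, rfl⟩ : ∃ g, I = Ideal.span {g} :=
    ⟨_, (Submodule.IsPrincipal.span_singleton_generator I).symm⟩
  rw [Ideal.span_singleton_eq_top, Int.isUnit_iff_natAbs_eq]
  by_contra hne
  obtain ⟨p, hp, hpg⟩ := Nat.exists_prime_and_dvd hne
  obtain ⟨c, hpc, hc⟩ := h p hp
  exact hpc ((Int.natCast_dvd.2 hpg).trans (Ideal.mem_span_singleton.1 hc))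

/-- The integers that multiply $e_k(y^a)$ into `lowDegree` form an ideal contained in no $(p)$. -/
lemma e_mem_lowDegree {a : Fin m →₀ ℕ} (ha : IsPrimitive a) {k : ℕ} (hk : 1 ≤ k)
    (hn1 : 1 ≤ n) {i₀ : Fin m} (hn : n ≤ k * a i₀) (hdeg : n < k * a.degree) :
    e n k (mon ℤ a) ∈ lowDegree ℤ n m (k * a.degree) := by
  by_cases hb : a.erase i₀ = 0
  · have has : a = a i₀ • Finsupp.single i₀ 1 := by
      have := Finsupp.single_add_erase i₀ a
      rw [hb, add_zero] at this
      rw [Finsupp.smul_single, smul_eq_mul, mul_one, this]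
    have := ha.2 _ _ has
    rw [← this, Finsupp.degree_single, mul_one] at hdeg
    rw [e_eq_zero hdeg]
    exact zero_mem _
  · let I : Ideal ℤ := (Subalgebra.toSubmodule (lowDegree ℤ n m (k * a.degree))).comap
      (LinearMap.toSpanSingleton ℤ _ (e n k (mon ℤ a)))
    have hI : I = ⊤ := ideal_eq_top_of_forall_prime fun p hp =>
      exists_smul_e_mem_lowDegree ha hk hn1 hn hb hp
    have h1 : (1 : ℤ) ∈ I := hI ▸ Submodule.mem_top
    have h2 : (1 : ℤ) • e n k (mon ℤ a) ∈ lowDegree ℤ n m (k * a.degree) := h1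
    rwa [one_smul] at h2

/-- The `e_k(μ)` with `μ` primitive, `1 ≤ k ≤ n` and `k l(μ)` at most `bound n m`. -/
def boundedGenerators (R : Type*) [CommRing R] (n m : ℕ) :
    Set (MvPolynomial (Fin m × Fin n) R) :=
  {g | ∃ (a : Fin m →₀ ℕ) (k : ℕ), IsPrimitive a ∧ 1 ≤ k ∧ k ≤ n ∧ k * a.degree ≤ bound n m ∧
    g = e n k (mon R a)}

lemma e_mem_adjoin_boundedGenerators_int (hn1 : 1 ≤ n) {a : Fin m →₀ ℕ} (ha : IsPrimitive a)
    {k : ℕ} (hk : 1 ≤ k) : e n k (mon ℤ a) ∈ Algebra.adjoin ℤ (boundedGenerators ℤ n m) := by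
  induction hD : k * a.degree using Nat.strong_induction_on generalizing a k with
  | _ D ih =>
    by_cases hkn : n < k
    · rw [e_eq_zero hkn]
      exact zero_mem _
    by_cases hb : k * a.degree ≤ bound n m
    · exact Algebra.subset_adjoin ⟨a, k, ha, hk, by omega, hb, rfl⟩
    -- If all $k a_i\le n-1$, the degree is at most $m(n-1)$.
    have hex : ∃ i₀, n ≤ k * a i₀ := by
      by_contra! hcon
      apply hb
      refine le_trans ?_ (le_max_right _ _)
      rw [Finsupp.degree_eq_sum, mul_sum]
      calc ∑ i, k * a i ≤ ∑ _i : Fin m, (n - 1) := sum_le_sum fun i _ => by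
            have := hcon i
            omega
        _ = m * (n - 1) := by simp
    obtain ⟨i₀, hi₀⟩ := hex
    have hmem := e_mem_lowDegree ha hk hn1 hi₀ (by
      have := le_max_left n (m * (n - 1))
      rw [bound] at hb
      omega)
    refine Algebra.adjoin_le ?_ hmem
    rintro _ ⟨b, l, hbp, hl, hlt, rfl⟩
    exact ih _ (hD ▸ hlt) hbp hl rfl

lemma map_e_mon (k : ℕ) (a : Fin m →₀ ℕ) :
    MvPolynomial.map (Int.castRingHom R) (e n k (mon ℤ a)) = e n k (mon R a) := by
  simp [e_mon, map_monomial]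

lemma e_mem_adjoin_boundedGenerators (hn1 : 1 ≤ n) {a : Fin m →₀ ℕ} (ha : IsPrimitive a)
    {k : ℕ} (hk : 1 ≤ k) : e n k (mon R a) ∈ Algebra.adjoin R (boundedGenerators R n m) := by
  rw [← map_e_mon]
  have hmem := e_mem_adjoin_boundedGenerators_int hn1 ha hk
  generalize e n k (mon ℤ a) = f at hmem ⊢
  induction hmem using Algebra.adjoin_induction with
  | mem f hf =>
    obtain ⟨b, l, hb, hl, hln, hlb, rfl⟩ := hf
    rw [map_e_mon]
    exact Algebra.subset_adjoin ⟨b, l, hb, hl, hln, hlb, rfl⟩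
  | algebraMap r =>
    rw [algebraMap_eq, map_C]
    exact Subalgebra.algebraMap_mem _ _
  | add f g _ _ hf hg =>
    rw [map_add]
    exact add_mem hf hg
  | mul f g _ _ hf hg =>
    rw [map_mul]
    exact mul_mem hf hg

lemma totalDegree_e_mon_le (k : ℕ) (a : Fin m →₀ ℕ) :
    (e n k (mon R a)).totalDegree ≤ k * a.degree := by
  refine Finset.sup_le fun α hα => ?_
  change α.degree ≤ _
  have h := isWeightedHomogeneous_e_mon k a (mem_support_iff.1 hα)
  rw [weight_multiweight] at h
  rw [← degree_mapDomain_fst, h]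
  simp

theorem adjoin_e_of_totalDegree_le_bound (hn1 : 1 ≤ n) :
    Algebra.adjoin R {g : MvPolynomial (Fin m × Fin n) R |
        ∃ (a : Fin m →₀ ℕ) (k : ℕ), IsPrimitive a ∧ 1 ≤ k ∧ k ≤ n ∧
          (e n k (mon R a)).totalDegree ≤ bound n m ∧ g = e n k (mon R a)} =
      invariants R n m := by
  refine le_antisymm (Algebra.adjoin_le ?_) ?_
  · rintro _ ⟨a, k, -, -, -, -, rfl⟩
    exact e_mem_invariants _ _
  · rw [← adjoin_primitiveGenerators]
    refine Algebra.adjoin_le ?_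
    rintro _ ⟨a, k, ha, hk, -, rfl⟩
    refine Algebra.adjoin_mono ?_ (e_mem_adjoin_boundedGenerators hn1 ha hk)
    rintro _ ⟨b, l, hb, hl, hln, hlb, rfl⟩
    exact ⟨b, l, hb, hl, hln, (totalDegree_e_mon_le l b).trans hlb, rfl⟩

end DegreeBound

end Multisymmetric

namespace Multisymmetric

open MvPolynomial Finset

/-! ### Power sums when $R$ contains $\mathbb Q$ -/

section PowerSums

variable {R : Type*} [CommRing R] {n m : ℕ}

/-- The sum of `y^{a 0}(j_0) ⋯ y^{a (r-1)}(j_{r-1})` over distinct indices `j_0, …, j_{r-1}`. -/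
noncomputable def injSum (R : Type*) [CommRing R] (n : ℕ) {m r : ℕ} (a : Fin r → Fin m →₀ ℕ) :
    MvPolynomial (Fin m × Fin n) R :=
  ∑ ι : Fin r ↪ Fin n, ∏ i, at_ (mon R (a i)) (ι i)

lemma e_one (f : MvPolynomial (Fin m) R) :
    (e n 1 f : MvPolynomial (Fin m × Fin n) R) = ∑ j, at_ f j := by
  simp [e_eq_sum, powersetCard_one]

lemma sum_notMem_range {A : Type*} [AddCommGroup A] {r : ℕ} (ι : Fin r ↪ Fin n) (f : Fin n → A) :
    ∑ j : {j // j ∉ Set.range ι}, f j = ∑ j, f j - ∑ k, f (ι k) := by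
  classical
  rw [eq_sub_iff_add_eq', Fintype.sum_equiv (Equiv.ofInjective ι ι.injective) (fun k => f (ι k))
    (fun j : {j // j ∈ Set.range ι} => f j) (fun k => rfl)]
  convert Fintype.sum_subtype_add_sum_subtype (fun j => j ∈ Set.range ι) f

/-- A further index either avoids the range of `ι` or equals some `ι k`, where `b` merges into `a
k`. -/
lemma injSum_cons {r : ℕ} (b : Fin m →₀ ℕ) (a : Fin r → Fin m →₀ ℕ) :
    injSum R n (Fin.cons b a : Fin (r + 1) → Fin m →₀ ℕ) = e n 1 (mon R b) * injSum R n a -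
      ∑ k, injSum R n (Function.update a k (a k + b)) := by
  classical
  have hup : ∀ (ι : Fin r ↪ Fin n) (k : Fin r),
      ∏ i, (at_ (mon R (Function.update a k (a k + b) i)) (ι i) : MvPolynomial (Fin m × Fin n) R) =
        at_ (mon R b) (ι k) * ∏ i, at_ (mon R (a i)) (ι i) := by
    intro ι k
    rw [← mul_prod_erase _ _ (mem_univ k), ← mul_prod_erase univ (fun i => at_ (mon R (a i)) (ι i))
      (mem_univ k), Function.update_self, mon_add, at_mul, mul_comm (at_ _ _), mul_assoc]
    congr 2
    refine prod_congr rfl fun i hi => ?_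
    rw [Function.update_of_ne (mem_erase.1 hi).1]
  simp_rw [injSum]
  rw [sum_comm, mul_sum, ← sum_sub_distrib]
  simp_rw [hup, ← sum_mul, ← sub_mul, e_one, ← sum_notMem_range]
  rw [← (Equiv.embeddingFinSucc r (Fin n)).symm.sum_comp, Fintype.sum_sigma]
  refine sum_congr rfl fun ι _ => ?_
  rw [sum_mul]
  refine sum_congr rfl fun j _ => ?_
  rw [Fin.prod_univ_succ]
  simp

/-- The subalgebra generated by the `e_1(μ)` with `0 < l(μ) < D`. -/
noncomputable def lowPowerSums (R : Type*) [CommRing R] (n m D : ℕ) :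
    Subalgebra R (MvPolynomial (Fin m × Fin n) R) :=
  Algebra.adjoin R {g | ∃ a : Fin m →₀ ℕ, a ≠ 0 ∧ a.degree < D ∧ g = e n 1 (mon R a)}

lemma lowPowerSums_mono {D D' : ℕ} (h : D ≤ D') : lowPowerSums R n m D ≤ lowPowerSums R n m D' := by
  refine Algebra.adjoin_mono ?_
  rintro _ ⟨a, ha, hd, rfl⟩
  exact ⟨a, ha, hd.trans_le h, rfl⟩

/-- From `r` to `r + 1` there are `r + 1` ways to merge the first part into another, each with sign
$-1$. The remaining term is a product of elements of lower degree. -/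
lemma injSum_sub_mem_lowPowerSums (r : ℕ) (a : Fin (r + 1) → Fin m →₀ ℕ) (ha : ∀ i, a i ≠ 0) :
    injSum R n a - ((-1) ^ r * (r.factorial : R)) • e n 1 (mon R (∑ i, a i)) ∈
      lowPowerSums R n m (∑ i, a i).degree := by
  induction r with
  | zero =>
    have h : injSum R n a = e n 1 (mon R (a 0)) := by
      rw [← Fin.cons_self_tail a, injSum_cons]
      simp [injSum]
    rw [h]
    simp
  | succ r ih =>
    have hne : ∀ x : Fin m →₀ ℕ, x ≠ 0 → x.degree ≠ 0 := fun x hx => by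
      rwa [Ne, Finsupp.degree_eq_zero_iff]
    have hsum : ∑ i, a i = a 0 + ∑ i, Fin.tail a i := Fin.sum_univ_succ a
    have htail : ∀ i, Fin.tail a i ≠ 0 := fun i => ha _
    have htail0 : ∑ i, Fin.tail a i ≠ 0 := by
      rw [Fin.sum_univ_succ]
      exact fun h => htail 0 (add_eq_zero.1 h).1
    have hdeg : (∑ i, a i).degree = (a 0).degree + (∑ i, Fin.tail a i).degree := by
      rw [hsum, map_add]
    have h0 := hne _ (ha 0)
    have h1 := hne _ htail0
    have hb : e n 1 (mon R (a 0)) ∈ lowPowerSums R n m (∑ i, a i).degree :=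
      Algebra.subset_adjoin ⟨_, ha 0, by omega, rfl⟩
    have ht : injSum R n (Fin.tail a) ∈ lowPowerSums R n m (∑ i, a i).degree := by
      have h2 := lowPowerSums_mono (D' := (∑ i, a i).degree) (by omega) (ih (Fin.tail a) htail)
      have h3 : e n 1 (mon R (∑ i, Fin.tail a i)) ∈ lowPowerSums R n m (∑ i, a i).degree :=
        Algebra.subset_adjoin ⟨_, htail0, by omega, rfl⟩
      have h4 := add_mem h2 (Subalgebra.smul_mem _ h3 ((-1) ^ r * (r.factorial : R)))
      rwa [sub_add_cancel] at h4
    have hk : ∀ k, injSum R n (Function.update (Fin.tail a) k (Fin.tail a k + a 0)) -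
        ((-1) ^ r * (r.factorial : R)) • e n 1 (mon R (∑ i, a i)) ∈
          lowPowerSums R n m (∑ i, a i).degree := by
      intro k
      have hs : ∑ i, Function.update (Fin.tail a) k (Fin.tail a k + a 0) i = ∑ i, a i := by
        rw [hsum, sum_update_of_mem (mem_univ k), sdiff_singleton_eq_erase,
          ← add_sum_erase _ (Fin.tail a) (mem_univ k)]
        abel
      rw [← hs]
      refine ih _ fun i => ?_
      by_cases hik : i = k
      · subst hik
        rw [Function.update_self]
        exact fun h => htail i (add_eq_zero.1 h).1
      · rw [Function.update_of_ne hik]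
        exact htail i
    have hrec := injSum_cons (R := R) (n := n) (a 0) (Fin.tail a)
    rw [Fin.cons_self_tail] at hrec
    have hfinal := sub_mem (mul_mem hb ht) (sum_mem fun k (_ : k ∈ univ) => hk k)
    convert hfinal using 1
    rw [hrec, sum_sub_distrib, sum_const, card_univ, Fintype.card_fin, Nat.factorial_succ]
    simp only [← Nat.cast_smul_eq_nsmul R, smul_smul]
    rw [show (-1 : R) ^ (r + 1) * (((r + 1) * r.factorial : ℕ) : R) =
      -(((r + 1 : ℕ) : R) * ((-1) ^ r * (r.factorial : R))) by push_cast; ring, neg_smul]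
    abel

lemma exists_sum_eq_of_lt_degree (r : ℕ) (a : Fin m →₀ ℕ) (h : r < a.degree) :
    ∃ c : Fin (r + 1) → Fin m →₀ ℕ, (∀ i, c i ≠ 0) ∧ ∑ i, c i = a := by
  induction r generalizing a with
  | zero =>
    refine ⟨fun _ => a, fun _ h0 => ?_, by simp⟩
    have h0 : a = 0 := h0
    simp [h0] at h
  | succ r ih =>
    have ha : a ≠ 0 := by
      rintro rfl
      simp at h
    obtain ⟨i, hi⟩ := Finsupp.ne_iff.1 ha
    rw [Finsupp.zero_apply] at hi
    have hle : Finsupp.single i 1 ≤ a := by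
      rw [Finsupp.single_le_iff]
      omega
    have hsplit : Finsupp.single i 1 + (a - Finsupp.single i 1) = a := add_tsub_cancel_of_le hle
    have hdeg := congrArg Finsupp.degree hsplit
    rw [map_add, Finsupp.degree_single] at hdeg
    obtain ⟨c, hc, hcs⟩ := ih (a - Finsupp.single i 1) (by omega)
    refine ⟨Fin.cons (Finsupp.single i 1) c, fun k => ?_, ?_⟩
    · refine Fin.cases ?_ (fun k => ?_) k
      · simp
      · simpa using hc k
    · rw [Fin.sum_cons, hcs, hsplit]

/-- Split $\mu$ into $n+1$ nontrivial factors: no $n+1$ distinct indices exist, so `injSum` is zero,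
and $n!$ is invertible. -/
lemma e_one_mem_lowPowerSums (hR : Nonempty (ℚ →+* R)) {a : Fin m →₀ ℕ} (ha : n < a.degree) :
    e n 1 (mon R a) ∈ lowPowerSums R n m a.degree := by
  obtain ⟨φ⟩ := hR
  obtain ⟨c, hc, rfl⟩ := exists_sum_eq_of_lt_degree n a ha
  have h := injSum_sub_mem_lowPowerSums (R := R) (n := n) n c hc
  have hempty : IsEmpty (Fin (n + 1) ↪ Fin n) :=
    Function.Embedding.isEmpty_of_card_lt (by simp)
  have h0 : injSum R n c = 0 := by simp [injSum]
  have hu : IsUnit ((-1) ^ n * (n.factorial : R)) := by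
    refine (isUnit_one.neg.pow n).mul ?_
    rw [← map_natCast φ]
    exact (IsUnit.mk0 (n.factorial : ℚ) (by exact_mod_cast n.factorial_ne_zero)).map φ
  obtain ⟨u, hu⟩ := hu
  rw [h0, zero_sub, ← hu] at h
  have h2 := Subalgebra.smul_mem _ (neg_mem h) (↑u⁻¹ : R)
  rwa [neg_neg, smul_smul, Units.inv_mul, one_smul] at h2

lemma e_one_mem_adjoin (hR : Nonempty (ℚ →+* R)) {a : Fin m →₀ ℕ} (ha : a ≠ 0) :
    e n 1 (mon R a) ∈ Algebra.adjoin R {g : MvPolynomial (Fin m × Fin n) R |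
      ∃ a : Fin m →₀ ℕ, a ≠ 0 ∧ a.degree ≤ n ∧ g = e n 1 (mon R a)} := by
  induction hD : a.degree using Nat.strong_induction_on generalizing a with
  | _ D ih =>
    by_cases h : a.degree ≤ n
    · exact Algebra.subset_adjoin ⟨a, ha, h, rfl⟩
    · refine Algebra.adjoin_le ?_ (e_one_mem_lowPowerSums hR (not_le.1 h))
      rintro _ ⟨b, hb, hlt, rfl⟩
      exact ih _ (hD ▸ hlt) hb rfl

/-- Newton's identities for the `e_k(μ)`. -/
lemma natCast_mul_e_mon (k : ℕ) (a : Fin m →₀ ℕ) :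
    (k : MvPolynomial (Fin m × Fin n) R) * e n k (mon R a) = (-1) ^ (k + 1) *
      ∑ u ∈ HasAntidiagonal.antidiagonal k with u.1 < k,
        (-1) ^ u.1 * e n u.1 (mon R a) * e n 1 (mon R (u.2 • a)) := by
  have h := congrArg (aeval fun j : Fin n =>
    (at_ (mon R a) j : MvPolynomial (Fin m × Fin n) R)) (mul_esymm_eq_sum (Fin n) R k)
  simp only [map_mul, map_natCast, map_pow, map_neg, map_one, map_sum, psum, aeval_X] at h
  simp_rw [e_one, mon_nsmul, at_pow]
  exact h

theorem adjoin_e_one (hR : Nonempty (ℚ →+* R)) :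
    Algebra.adjoin R {g : MvPolynomial (Fin m × Fin n) R |
        ∃ a : Fin m →₀ ℕ, a ≠ 0 ∧ a.degree ≤ n ∧ g = e n 1 (mon R a)} =
      invariants R n m := by
  refine le_antisymm (Algebra.adjoin_le ?_) ?_
  · rintro _ ⟨a, -, -, rfl⟩
    exact e_mem_invariants _ _
  · rw [← adjoin_primitiveGenerators]
    refine Algebra.adjoin_le ?_
    rintro _ ⟨a, k, ha, -, -, rfl⟩
    induction k using Nat.strong_induction_on with
    | _ k ih =>
      rcases Nat.eq_zero_or_pos k with rfl | hk
      · rw [e, esymm_zero, map_one]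
        exact one_mem _
      -- Newton's identities express $k\,e_k(\mu)$ through $e_l(\mu)$ with $l<k$ and power sums
      -- $e_1(\mu^l)$; `k` is invertible.
      have hmem : (k : MvPolynomial (Fin m × Fin n) R) * e n k (mon R a) ∈
          Algebra.adjoin R {g : MvPolynomial (Fin m × Fin n) R |
            ∃ a : Fin m →₀ ℕ, a ≠ 0 ∧ a.degree ≤ n ∧ g = e n 1 (mon R a)} := by
        rw [natCast_mul_e_mon]
        refine mul_mem (pow_mem (neg_mem (one_mem _)) _) (sum_mem fun u hu => ?_)
        rw [mem_filter, HasAntidiagonal.mem_antidiagonal] at hu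
        exact mul_mem (mul_mem (pow_mem (neg_mem (one_mem _)) _) (ih _ hu.2))
          (e_one_mem_adjoin hR (smul_ne_zero (by omega) ha.1))
      obtain ⟨φ⟩ := hR
      have hu : IsUnit (k : R) := by
        rw [← map_natCast φ]
        exact (IsUnit.mk0 (k : ℚ) (by exact_mod_cast hk.ne')).map φ
      obtain ⟨u, hu⟩ := hu
      have h2 := Subalgebra.smul_mem _ hmem (↑u⁻¹ : R)
      rw [← nsmul_eq_mul, ← Nat.cast_smul_eq_nsmul R, ← hu, smul_smul, Units.inv_mul,
        one_smul] at h2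
      exact h2

end PowerSums

end Multisymmetric

theorem theorem1p14 {R : Type*} [CommRing R] (n m : ℕ) (hn : 1 ≤ n) (hm : 1 ≤ m) :
    -- generation over an arbitrary commutative ring
    Algebra.adjoin R {g : MvPolynomial (Fin m × Fin n) R |
        ∃ (a : Fin m →₀ ℕ) (k : ℕ), Multisymmetric.IsPrimitive a ∧ 1 ≤ k ∧ k ≤ n ∧
          (Multisymmetric.e n k (Multisymmetric.mon R a)).totalDegree
            ≤ Multisymmetric.bound n m ∧
          g = Multisymmetric.e n k (Multisymmetric.mon R a)}
      = Multisymmetric.invariants R n m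
    ∧
    -- the bound is attained when `n = p ^ s` and `R = ℤ` or `p = 0` in `R`
    (∀ p s : ℕ, p.Prime → n = p ^ s → Nontrivial R →
      (Nonempty (R ≃+* ℤ) ∨ (p : R) = 0) →
      ∀ G : Set (MvPolynomial (Fin m × Fin n) R),
        Algebra.adjoin R G = Multisymmetric.invariants R n m →
        (∃ g ∈ G, Multisymmetric.bound n m ≤ g.totalDegree) ∧
        ((∀ g ∈ G, ∃ d : ℕ, g.IsHomogeneous d) →
          ∃ g ∈ G, g.totalDegree = Multisymmetric.bound n m))
    ∧
    -- generation by the `e_1(μ)` when `R ⊇ ℚ`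
    (Nonempty (ℚ →+* R) →
      Algebra.adjoin R {g : MvPolynomial (Fin m × Fin n) R |
          ∃ a : Fin m →₀ ℕ, a ≠ 0 ∧ a.degree ≤ n ∧
            g = Multisymmetric.e n 1 (Multisymmetric.mon R a)}
        = Multisymmetric.invariants R n m) :=
  ⟨Multisymmetric.adjoin_e_of_totalDegree_le_bound hn,
    fun _ _ hp hnp _ h G hG => Multisymmetric.bound_attained hp hnp hm h G hG,
    Multisymmetric.adjoin_e_one⟩
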